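/- Multicast networks. A multicast network is a finite directed acyclic multigraph with unit-capacity edges, a source node $s$ without incoming edges and a set of receivers; its source dimension $\omega$ is the out-degree of $s$. A linear network code over $\mathrm{GF}(q)$ assigns to every pair $(a,e)$ of edges a coefficient $k_{a,e}\in \mathrm{GF}(q)$, with $k_{a,e}=0$ unless $a$ ends at the node where $e$ starts. It determines coding vectors $f_e\in \mathrm{GF}(q)^{\omega}$: the $\omega$ outgoing edges of $s$ carry the unit vectors, and $f_e=\sum_a k_{a,e}f_a$ for every other edge $e$. The network is linearly solvable over $\mathrm{GF}(q)$ if for some code the matrix $[f_e]_{e\in \mathrm{In}(t)}$ has rank $\omega$ for every receiver $t$, where $\mathrm{In}(t)$ is the set of edges entering $t$. Let $q_{\min}$ be the least size of a finite field over which the network is linearly solvable, and $q^*_{\max}$ the largest size of a finite field over which it is not linearly solvable ($q^*_{\max}=1$ if it is linearly solvable over every finite field). The network $\mathcal N_{\omega,\mathbf d}$. For $\omega\ge 3$ and integers $d_1,\dots,d_\omega\geq 2$, $\mathcal N_{\omega,\mathbf d}$ has a source $s$; nodes $u_1,\dots,u_\omega$, each with one incoming edge, from $s$; nodes $v_1,\dots,v_\omega$,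 where $v_i$ has two incoming edges, one from $u_i$ and one from $u_{i-1}$ (with $u_0=u_\omega$); for each $i$, nodes $n_{i,1},\dots,n_{i,d_i}$, each with one incoming edge, from $v_i$; and, for every set $N$ of $\omega$ of the nodes $n_{i,j}$ for which the maximum number of edge-disjoint paths from $s$ ending at nodes of $N$ is $\omega$, a receiver with one incoming edge from each node of $N$. Theorem. Let $k>2$ be an integer, $q=2^{2k}$ and $d=\frac{2^{2k}-1}{3}$. Let $\omega\ge 3$ be an integer such that, with $q'=2q=2^{2k+1}$, $$\omega\ \ge\ \max\left\{\frac{\frac{q'-1}{d'}-\left\lceil\frac{q-d-1}{d'}\right\rceil}{\left\lceil\frac{d}{d'}\right\rceil-1}+1\ :\ 1\le d'<d,\ d'\mid q'-1\right\},$$ and let $\mathbf d=(d,\dots,d,2d)$ be the $\omega$-tuple whose first $\omega-1$ entries are $d$. Then $\mathcal N_{\omega,\mathbf d}$ is linearly solvable over $\mathrm{GF}(2^{2k})$ but not over $\mathrm{GF}(2^{2k+1})$. Moreover, for this network $q_{\min}=2^{2k}$, and $q^*_{\max}=2^{2k'+1}$ for some integer $k'\ge k$. -/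

import Mathlib

namespace MulticastNetwork

/-- A directed multigraph with nodes `V` and edges `E`; parallel edges are allowed. -/
structure MultiDigraph (V E : Type) where
  /-- the node an edge leaves -/
  tail : E → V
  /-- the node an edge enters -/
  head : E → V

namespace MultiDigraph

variable {V E : Type}

/-- `G.Step a b`: there is an edge from `a` to `b`. -/
def Step (G : MultiDigraph V E) (a b : V) : Prop :=
  ∃ e : E, G.tail e = a ∧ G.head e = b

/-- No directed cycle: no node can be reached from itself by one or more edges. -/
def Acyclic (G : MultiDigraph V E) : Prop :=
  ∀ v : V, ¬ Relation.TransGen G.Step v v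

/-- `G.IsPath a b p`: the nonempty list of edges `p` is a directed path from `a` to `b`. -/
inductive IsPath (G : MultiDigraph V E) : V → V → List E → Prop
  | single (e : E) : IsPath G (G.tail e) (G.head e) [e]
  | cons (e : E) {b : V} {p : List E} (h : IsPath G (G.head e) b p) :
      IsPath G (G.tail e) b (e :: p)

/-- There are `m` pairwise edge-disjoint paths starting from `s` and ending at nodes in `N`. -/
def HasDisjointPaths (G : MultiDigraph V E) (s : V) (N : Set V) (m : ℕ) : Prop :=
  ∃ P : Fin m → List E,
    (∀ i, ∃ v ∈ N, G.IsPath s v (P i)) ∧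
    ∀ i j, i ≠ j → List.Disjoint (P i) (P j)

/-- The maximum number of edge-disjoint paths starting from `s` and ending at nodes in `N`.
Paths are nonempty, so that this number is at most the number of edges of a finite graph. -/
noncomputable def maxflow (G : MultiDigraph V E) (s : V) (N : Set V) : ℕ :=
  sSup {m : ℕ | G.HasDisjointPaths s N m}

/-- Strictly increasing layers along edges exclude directed cycles. -/
theorem acyclic_of_layer (G : MultiDigraph V E) (l : V → ℕ)
    (h : ∀ e, l (G.tail e) < l (G.head e)) : G.Acyclic := by
  have key : ∀ a b, Relation.TransGen G.Step a b → l a < l b := by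
    intro a b hab
    induction hab with
    | single h1 =>
      obtain ⟨e, rfl, rfl⟩ := h1
      exact h e
    | tail _ h1 ih =>
      obtain ⟨e, rfl, rfl⟩ := h1
      exact ih.trans (h e)
  intro v hv
  exact lt_irrefl _ (key v v hv)

end MultiDigraph

/-- A multicast network: a finite directed acyclic multigraph with a source node and a set of
receivers. All edges have unit capacity. -/
structure Network where
  /-- nodes -/
  V : Type
  /-- edges -/
  E : Type
  finiteV : Finite V
  fintypeE : Fintype E
  /-- the underlying directed multigraph -/
  graph : MultiDigraph V E
  acyclic : graph.Acyclic
  /-- the source node -/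
  source : V
  source_no_in : ∀ e, graph.head e ≠ source
  /-- the receivers -/
  receivers : Set V

attribute [instance] Network.finiteV Network.fintypeE

namespace Network

/-- The outgoing edges of the source; their number is the source dimension. -/
abbrev Out (N : Network) : Type := {e : N.E // N.graph.tail e = N.source}

/-- The incoming edges of a node. -/
abbrev In (N : Network) (v : N.V) : Type := {e : N.E // N.graph.head e = v}

/-- The source dimension, i.e. the out-degree of the source. -/
noncomputable def dim (N : Network) : ℕ := Nat.card N.Out

/-- A linear network code: a coding coefficient for every pair of edges, which is zero on pairs
that are not adjacent. -/
def IsCode (N : Network) {F : Type*} [Field F] (c : N.E → N.E → F) : Prop :=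
  ∀ a e, N.graph.head a ≠ N.graph.tail e → c a e = 0

open Classical in
/-- `f` is the family of coding vectors determined by the code `c`: the outgoing edges of the
source carry the unit vectors, and any other edge carries the linear combination, prescribed by
the coding coefficients, of the coding vectors of the edges entering its tail. (As the network is
acyclic and finite, `f` is uniquely determined by `c`.) -/
def IsCodingVectors (N : Network) {F : Type*} [Field F] (c : N.E → N.E → F)
    (f : N.E → N.Out → F) : Prop :=
  (∀ e : N.Out, f e.1 = Pi.single e 1) ∧
  (∀ e : N.E, N.graph.tail e ≠ N.source → f e = ∑ a : N.E, c a e • f a)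

open Classical in
/-- The network has a linear solution over the field `F`: a linear network code such that at every
receiver `t` the matrix of the coding vectors of the incoming edges of `t` has full rank, namely
the source dimension. -/
def LinearlySolvable (N : Network) (F : Type*) [Field F] : Prop :=
  ∃ (c : N.E → N.E → F) (f : N.E → N.Out → F),
    N.IsCode c ∧ N.IsCodingVectors c f ∧
    ∀ t ∈ N.receivers,
      (Matrix.of (fun (o : N.Out) (e : N.In t) => f e.1 o)).rank = N.dim

/-- The sizes of the finite fields over which the network is linearly solvable. -/
def solvableSizes (N : Network) : Set ℕ :=
  {q | ∃ (F : Type) (_ : Field F), Finite F ∧ Nat.card F = q ∧ N.LinearlySolvable F}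

/-- The sizes of the finite fields over which the network is not linearly solvable. -/
def unsolvableSizes (N : Network) : Set ℕ :=
  {q | ∃ (F : Type) (_ : Field F), Finite F ∧ Nat.card F = q ∧ ¬ N.LinearlySolvable F}

/-- `q` is the minimum field size for the existence of a linear solution. -/
def IsQMin (N : Network) (q : ℕ) : Prop := IsLeast N.solvableSizes q

/-- `q` is the maximum field size for the nonexistence of a linear solution, with the convention
that it is `1` if the network is linearly solvable over all finite fields. -/
def IsQStarMax (N : Network) (q : ℕ) : Prop := IsGreatest (insert 1 N.unsolvableSizes) q

end Network

section Construction

variable (ω : ℕ) (d : Fin ω → ℕ)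

/-- The nodes on layers 1 to 4. -/
inductive UpperNode : Type
  /-- the source (layer 1) -/
  | s : UpperNode
  /-- the layer-2 nodes -/
  | u (i : Fin ω) : UpperNode
  /-- the layer-3 nodes -/
  | v (i : Fin ω) : UpperNode
  /-- the layer-4 nodes, `d i` of them below the layer-3 node `v i` -/
  | n (i : Fin ω) (j : Fin (d i)) : UpperNode

/-- The edges between nodes on layers 1 to 4. -/
inductive UpperEdge : Type
  /-- from the source to `u i` -/
  | su (i : Fin ω) : UpperEdge
  /-- from `u i` to `v i` -/
  | uv (i : Fin ω) : UpperEdge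
  /-- from `u (i - 1)`, indices being cyclic, to `v i` -/
  | uv' (i : Fin ω) : UpperEdge
  /-- from `v i` to `n i j` -/
  | vn (i : Fin ω) (j : Fin (d i)) : UpperEdge

variable {ω d}

/-- The cyclic predecessor of an index. -/
def cyclicPred (i : Fin ω) : Fin ω := (finRotate ω).symm i

/-- Tail of an edge on the upper four layers. -/
def UpperEdge.tail : UpperEdge ω d → UpperNode ω d
  | .su _ => .s
  | .uv i => .u i
  | .uv' i => .u (cyclicPred i)
  | .vn i _ => .v i

/-- Head of an edge on the upper four layers. -/
def UpperEdge.head : UpperEdge ω d → UpperNode ω d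
  | .su i => .u i
  | .uv i => .v i
  | .uv' i => .v i
  | .vn i j => .n i j

/-- Layer of a node on the upper four layers. -/
def UpperNode.layer : UpperNode ω d → ℕ
  | .s => 1
  | .u _ => 2
  | .v _ => 3
  | .n _ _ => 4

variable (ω d)

/-- The part of the network on layers 1 to 4. -/
def upperGraph : MultiDigraph (UpperNode ω d) (UpperEdge ω d) where
  tail := UpperEdge.tail
  head := UpperEdge.head

/-- The index set of the layer-4 nodes. -/
abbrev GreyIndex : Type := Σ i : Fin ω, Fin (d i)

/-- The layer-4 node with a given index. -/
def grey (x : GreyIndex ω d) : UpperNode ω d := .n x.1 x.2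

/-- The layer-5 nodes: one for every set of `ω` layer-4 nodes to which the maximum flow from the
source is `ω`. (A layer-5 node has no outgoing edge, so that the maximum flow to layer-4 nodes may
be taken in the upper four layers.) -/
abbrev Receiver : Type :=
  {N : Finset (GreyIndex ω d) //
    N.card = ω ∧ (upperGraph ω d).maxflow .s (grey ω d '' (N : Set (GreyIndex ω d))) = ω}

/-- All edges: those of the upper four layers, and for every receiver `N` an edge to it from every
layer-4 node in `N`. -/
abbrev FullEdge : Type := UpperEdge ω d ⊕ (Σ N : Receiver ω d, {x : GreyIndex ω d // x ∈ N.1})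

/-- The five-layer directed multigraph. -/
def fullGraph : MultiDigraph (UpperNode ω d ⊕ Receiver ω d) (FullEdge ω d) where
  tail
    | .inl e => .inl e.tail
    | .inr ⟨_, x⟩ => .inl (grey ω d x.1)
  head
    | .inl e => .inl e.head
    | .inr ⟨N, _⟩ => .inr N

instance : Finite (UpperNode ω d) := by
  refine Finite.of_injective
    (β := Unit ⊕ Fin ω ⊕ Fin ω ⊕ GreyIndex ω d)
    (fun x => match x with
      | .s => .inl ()
      | .u i => .inr (.inl i)
      | .v i => .inr (.inr (.inl i))
      | .n i j => .inr (.inr (.inr ⟨i, j⟩))) ?_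
  rintro (_ | i | i | ⟨i, j⟩) (_ | i' | i' | ⟨i', j'⟩) h <;> simp_all

instance : Finite (UpperEdge ω d) := by
  refine Finite.of_injective
    (β := Fin ω ⊕ Fin ω ⊕ Fin ω ⊕ GreyIndex ω d)
    (fun x => match x with
      | .su i => .inl i
      | .uv i => .inr (.inl i)
      | .uv' i => .inr (.inr (.inl i))
      | .vn i j => .inr (.inr (.inr ⟨i, j⟩))) ?_
  rintro (i | i | i | ⟨i, j⟩) (i' | i' | i' | ⟨i', j'⟩) h <;> simp_all

/-- The multicast network with parameters `ω` and `d = (d_1, …, d_ω)`. -/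
noncomputable def layeredNetwork : Network where
  V := UpperNode ω d ⊕ Receiver ω d
  E := FullEdge ω d
  finiteV := inferInstance
  fintypeE := Fintype.ofFinite _
  graph := fullGraph ω d
  acyclic := (fullGraph ω d).acyclic_of_layer
    (Sum.elim UpperNode.layer (fun _ => 5)) (by
      rintro (e | ⟨N, x⟩)
      · cases e <;> simp [fullGraph, UpperEdge.tail, UpperEdge.head, UpperNode.layer]
      · simp [fullGraph, grey, UpperNode.layer])
  source := .inl .s
  source_no_in := by
    rintro (e | ⟨N, x⟩)
    · cases e <;> simp [fullGraph, UpperEdge.head]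
    · simp [fullGraph]
  receivers := Set.range Sum.inr

end Construction

/-- The `ω`-tuple `(a, …, a, b)`: all entries are `a`, except that the last one is `b`. -/
def tupleWithLast (ω a b : ℕ) (i : Fin ω) : ℕ := if i.val + 1 = ω then b else a

/-- The bound
`ω ≥ max {((q' - 1)/d' - ⌈(q - d - 1)/d'⌉) / (⌈d/d'⌉ - 1) + 1 : 1 ≤ d' < d, d' ∣ q' - 1}`.
Here `⌈d/d'⌉ ≥ 2` because `d' < d`. -/
def SharpBound (ω q q' d : ℕ) : Prop :=
  ∀ d' : ℕ, 1 ≤ d' → d' < d → d' ∣ q' - 1 →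
    (((q' : ℚ) - 1) / (d' : ℚ) - (⌈((q : ℚ) - (d : ℚ) - 1) / (d' : ℚ)⌉ : ℚ)) /
        ((⌈(d : ℚ) / (d' : ℚ)⌉ : ℚ) - 1) + 1 ≤ (ω : ℚ)

end MulticastNetwork

/-! The layer-4 node `⟨i, j⟩` carries a combination of `e_i` and `e_{i-1}`. A functional `w` kills
it exactly when `w i = r * w (i - 1)`, where `r` is the negated ratio of its two coefficients. The
receivers lie below exactly those `ω`-sets of layer-4 nodes that can be matched to the layer-2
nodes. Hence the network is linearly solvable over `F` if and only if there are sets `A_i` of `d_i`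
units of `F` with `1 ∉ ∏ A_i` (`linearlySolvable_of_ratios`, `exists_ratios_of_linearlySolvable`). A
transversal of the `v_i` is a cyclic system of recurrences, singular exactly when its ratios have
product `1`.

The rest is arithmetic in the cyclic group `Fˣ`. For `q - 1 = 3d`, let all sets but the last be the
subgroup of order `d` and the last one its complement. For `|F| < q`, the pigeonhole principle
applied to the last set and one other already produces `1`.

For `q' - 1 = 6d + 1`, suppose `1` is not in the product, and let `H` be the stabilizer of the
product, of order `h` and index `N`. Kneser's theorem gives `∑ ⌈|A_i|/h⌉ - (ω - 1) ≤ N - 1`. If `h <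
d`, this contradicts the bound on `ω` at `d' = h`. If `h ≥ d`, then `2 ≤ N ≤ 6` and `N ∣ 6d + 1`,
which leaves only `N = 5`, impossible since an odd power of `2` is not `1` modulo `5`.

For `|F| ≥ q'`, a subgroup of index `2` (odd `|F|`) or `3` (even powers of `2`) gives a solution as
above, so only odd powers of `2` can fail. All sufficiently large fields succeed, so a largest
failing size exists. -/

namespace MulticastNetwork

/-! ### Kneser's theorem in finite commutative groups -/

section Kneser

open MulAction
open scoped Pointwise

variable {G : Type*} [CommGroup G]

theorem mul_stabilizer_self (D : Set G) : D * (stabilizer G D : Set G) = D := by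
  rw [mul_comm, stabilizer_mul_self]

/-- If `D` is periodic under `H`, then multiplying by `H` does not change it. -/
theorem mul_subgroup_eq_of_le_stabilizer {D : Set G} {H : Subgroup G}
    (h : H ≤ stabilizer G D) : D * (H : Set G) = D := by
  apply Set.Subset.antisymm
  · calc D * (H : Set G) ⊆ D * (stabilizer G D : Set G) := Set.mul_subset_mul_left h
      _ = D := mul_stabilizer_self D
  · exact Set.subset_mul_left _ H.one_mem

theorem mul_mem_iff_of_mem_stabilizer {D : Set G} {h : G} (hh : h ∈ stabilizer G D) (x : G) :
    x * h ∈ D ↔ x ∈ D := by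
  rw [mul_comm]
  exact mem_stabilizer_set.1 hh x

theorem mem_stabilizer_of_forall [Finite G] {D : Set G} {h : G} (H : ∀ x ∈ D, h * x ∈ D) :
    h ∈ stabilizer G D :=
  (mem_stabilizer_set' D.toFinite).2 H

theorem stabilizer_le_stabilizer_mul (A B : Set G) : stabilizer G A ≤ stabilizer G (A * B) := by
  intro g hg
  rw [mem_stabilizer_iff] at hg ⊢
  rw [← smul_mul_assoc, hg]

theorem ncard_smul_subgroup (a : G) (H : Subgroup G) :
    (a • (H : Set G)).ncard = Nat.card H := by
  rw [← Nat.card_coe_set_eq]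
  exact (Nat.card_congr (Subgroup.leftCosetEquivSubgroup a))

theorem card_dvd_ncard_of_le_stabilizer {D : Set G} {H : Subgroup G}
    (h : H ≤ stabilizer G D) : Nat.card H ∣ D.ncard := by
  have hD : D = QuotientGroup.mk ⁻¹' ((QuotientGroup.mk : G → G ⧸ H) '' D) := by
    rw [QuotientGroup.preimage_image_mk_eq_mul, mul_subgroup_eq_of_le_stabilizer h]
  rw [hD, ← Nat.card_coe_set_eq,
    Nat.card_congr (QuotientGroup.preimageMkEquivSubgroupProdSet H _), Nat.card_prod]
  exact dvd_mul_right _ _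

theorem mem_smul_subgroup {a x : G} {H : Subgroup G} : x ∈ a • (H : Set G) ↔ a⁻¹ * x ∈ H := by
  rw [Set.mem_smul_set_iff_inv_smul_mem]; rfl

theorem smul_subgroup_eq_of_mem {a x : G} {H : Subgroup G} (h : x ∈ a • (H : Set G)) :
    x • (H : Set G) = a • (H : Set G) := by
  rw [mem_smul_subgroup] at h
  exact (leftCoset_eq_iff H |>.2 h).symm

/-- The inequality of Kneser's theorem for a pair of sets. -/
def KneserIneq (A B : Set G) : Prop :=
  A.ncard + B.ncard ≤ (A * B).ncard + Nat.card (stabilizer G (A * B))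

/-- Thickening both factors by the stabilizer of `A * B` changes neither the product nor its
stabilizer, so the plain inequality for the thickened sets is this sharper one. -/
theorem kneserIneq_periodic {A B : Set G} (hA : A.Nonempty) (hB : B.Nonempty) {n : ℕ}
    (hn : (A * B).ncard < n)
    (ih : ∀ A' B' : Set G, A'.Nonempty → B'.Nonempty → (A' * B').ncard < n → KneserIneq A' B') :
    (A * (stabilizer G (A * B) : Set G)).ncard + (B * (stabilizer G (A * B) : Set G)).ncard ≤
      (A * B).ncard + Nat.card (stabilizer G (A * B)) := by
  set H := stabilizer G (A * B) with hH
  have h1 : (A * (H : Set G)) * (B * (H : Set G)) = A * B := by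
    rw [mul_mul_mul_comm, coe_mul_coe H, hH, mul_stabilizer_self]
  have hHn : (H : Set G).Nonempty := ⟨1, H.one_mem⟩
  have := ih (A * (H : Set G)) (B * (H : Set G)) (hA.mul hHn) (hB.mul hHn) (by rwa [h1])
  rw [KneserIneq, h1] at this
  exact this

variable [Finite G]

/-- `C` is a part of `A * B` that is periodic under `H` and of the size expected from `A ∩ B`
and `A ∪ B`. -/
structure IsConvergent (A B C : Set G) (H : Subgroup G) : Prop where
  nonempty : C.Nonempty
  subset : C ⊆ A * B
  le : H ≤ stabilizer G C
  card : (A ∩ B).ncard + ((A ∪ B) * (H : Set G)).ncard ≤ C.ncard + Nat.card H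

/-- By commutativity `(A ∩ B) * (A ∪ B) ⊆ A * B`. The induction hypothesis applies to this product
because `A ∩ B` is strictly smaller than `A`. -/
theorem exists_isConvergent {A B : Set G} (hint : (A ∩ B).Nonempty) (hnot : ¬ A ⊆ B)
    (ih : ∀ A' B' : Set G, A'.Nonempty → B'.Nonempty → (A' * B').ncard ≤ (A * B).ncard →
      A'.ncard < A.ncard → KneserIneq A' B') :
    ∃ C H, IsConvergent A B C H := by
  set C := (A ∩ B) * (A ∪ B) with hC
  have hsub : C ⊆ A * B := by
    rintro _ ⟨x, ⟨hxA, hxB⟩, y, hy | hy, rfl⟩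
    · exact ⟨y, hy, x, hxB, mul_comm _ _⟩
    · exact ⟨x, hxA, y, hy, rfl⟩
  have hUn : (A ∪ B).Nonempty := hint.mono (Set.inter_subset_left.trans Set.subset_union_left)
  refine ⟨C, stabilizer G C, hint.mul hUn, hsub, le_rfl, ?_⟩
  have h1 : (A ∩ B) * ((A ∪ B) * (stabilizer G C : Set G)) = C := by
    rw [← mul_assoc, ← hC, mul_stabilizer_self]
  have := ih (A ∩ B) ((A ∪ B) * (stabilizer G C : Set G)) hint
    (hUn.mul ⟨1, Subgroup.one_mem _⟩) (by rw [h1]; exact Set.ncard_le_ncard hsub)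
    (Set.ncard_lt_ncard (Set.inter_ssubset_left_iff.2 hnot))
  rwa [KneserIneq, h1] at this

/-- Holes of a set with respect to a larger period, counted in one coset. -/
theorem card_le_ncard_mul_sub {U W : Set G} {H H' : Subgroup G} {x : G} (hx : x ∈ U)
    (hle : H' ≤ H) (hW : U ∩ x • (H : Set G) ⊆ W) :
    Nat.card H + (U * (H' : Set G)).ncard ≤
      (U * (H : Set G)).ncard + (W * (H' : Set G)).ncard := by
  have h1 : x • (H : Set G) ⊆ U * (H : Set G) := by
    rintro _ ⟨h, hh, rfl⟩
    exact ⟨x, hx, h, hh, rfl⟩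
  have h2 : U * (H' : Set G) ⊆ U * (H : Set G) := Set.mul_subset_mul_left hle
  have h3 : x • (H : Set G) ∩ (U * (H' : Set G)) ⊆ W * (H' : Set G) := by
    rintro _ ⟨hy, u, hu, h, hh, rfl⟩
    refine ⟨u, hW ⟨hu, ?_⟩, h, hh, rfl⟩
    rw [mem_smul_subgroup] at hy ⊢
    have := H.mul_mem hy (H.inv_mem (hle hh))
    simpa [mul_assoc] using this
  have h4 := Set.ncard_union_add_ncard_inter (x • (H : Set G)) (U * (H' : Set G))
  have h5 := Set.ncard_le_ncard (Set.union_subset h1 h2)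
  have h6 := Set.ncard_le_ncard h3
  rw [ncard_smul_subgroup] at h4
  omega

/-- The product `D = A' * B'` lies in the coset `m H`, which misses `C` because `C` is `H`-periodic
and `m ∉ C`. Periods of `D` lie in `H`, and not all of `H` occurs, since otherwise `D = m H` would
contain `m`. So `C ∪ D` with the smaller group `stabilizer G D` violates minimality unless its size
condition fails, and that failure is the final inequality. -/
theorem IsConvergent.lt_of_minimal {A B C : Set G} {H : Subgroup G} (hC : IsConvergent A B C H)
    (hmin : ∀ C' H', IsConvergent A B C' H' → Nat.card H ≤ Nat.card H')
    {m x y : G} (hm : m ∉ A * B) (hmH : m ∈ (x * y) • (H : Set G))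
    {A' B' : Set G} (hA' : A' ⊆ A ∩ x • (H : Set G)) (hB' : B' ⊆ B ∩ y • (H : Set G))
    (hA : A'.Nonempty) (hB : B'.Nonempty) :
    Disjoint C (A' * B') ∧ stabilizer G (A' * B') ≤ H ∧
    (A' * B').ncard + Nat.card (stabilizer G (A' * B')) + ((A ∪ B) * (H : Set G)).ncard <
      Nat.card H + ((A ∪ B) * (stabilizer G (A' * B') : Set G)).ncard := by
  set D := A' * B' with hD
  have hDsub : D ⊆ A * B := Set.mul_subset_mul (hA'.trans Set.inter_subset_left)
    (hB'.trans Set.inter_subset_left)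
  have hDH : D ⊆ m • (H : Set G) := by
    rintro _ ⟨a, ha, b, hb, rfl⟩
    have h1 := mem_smul_subgroup.1 (hA' ha).2
    have h2 := mem_smul_subgroup.1 (hB' hb).2
    have h3 := mem_smul_subgroup.1 hmH
    rw [mem_smul_subgroup]
    have := H.mul_mem (H.mul_mem h1 h2) (H.inv_mem h3)
    convert this using 1
    simp only [mul_inv_rev, inv_inv]
    have : x⁻¹ * a * (y⁻¹ * b) * (m⁻¹ * (x * y)) = m⁻¹ * (a * b) * (x⁻¹ * x) * (y⁻¹ * y) := by
      simp only [mul_comm, mul_left_comm, mul_assoc]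
    simp [this]
  have hdisj : Disjoint C D := by
    rw [Set.disjoint_left]
    intro z hzC hzD
    have := mem_smul_subgroup.1 (hDH hzD)
    have h1 := (mul_mem_iff_of_mem_stabilizer (hC.le (H.inv_mem this)) z).2 hzC
    apply hm
    apply hC.subset
    simpa using h1
  obtain ⟨z, hz⟩ : D.Nonempty := hA.mul hB
  have hle : stabilizer G D ≤ H := by
    intro g hg
    have h1 : z * g ∈ D := (mul_mem_iff_of_mem_stabilizer hg z).2 hz
    have h2 := mem_smul_subgroup.1 (hDH hz)
    have h3 := mem_smul_subgroup.1 (hDH h1)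
    rw [← mul_assoc] at h3
    exact (H.mul_mem_cancel_left h2).1 h3
  have hne : stabilizer G D ≠ H := by
    intro h
    have h2 := mem_smul_subgroup.1 (hDH hz)
    rw [← h] at h2
    have := (mul_mem_iff_of_mem_stabilizer (inv_mem h2) z).2 hz
    apply hm
    apply hDsub
    simpa using this
  refine ⟨hdisj, hle, ?_⟩
  have hlt : Nat.card (stabilizer G D) < Nat.card H := by
    have := Set.ncard_lt_ncard (s := (stabilizer G D : Set G)) (t := (H : Set G))
      (lt_of_le_of_ne hle (fun h => hne (SetLike.coe_injective h)))
    rwa [← Nat.card_coe_set_eq, ← Nat.card_coe_set_eq] at this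
  by_contra hcon
  have := hmin (C ∪ D) (stabilizer G D) ⟨hC.nonempty.mono Set.subset_union_left,
    Set.union_subset hC.subset hDsub,
    (le_inf (hle.trans hC.le) le_rfl).trans stabilizer_inf_stabilizer_le_stabilizer_union, by
      rw [Set.ncard_union_eq hdisj]
      have := hC.card
      omega⟩
  omega

/-- Take a convergent `C` with `H` smallest. If `H` stabilizes `A * B`, the size of `C` already
gives the inequality. Otherwise some coset `a b H` is only partly filled by `A * B`. Both ways of
splitting it, `aH · bH` and `bH · aH`, give pieces disjoint from `C`, and counting holes of `A ∪ B`
in `aH` and `bH` yields a contradiction. -/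
theorem kneserIneq_of_inter {A B : Set G} (hint : (A ∩ B).Nonempty) (hnot : ¬ A ⊆ B)
    (ih : ∀ A' B' : Set G, A'.Nonempty → B'.Nonempty → (A' * B').ncard < (A * B).ncard →
      KneserIneq A' B')
    (ih' : ∀ A' B' : Set G, A'.Nonempty → B'.Nonempty → (A' * B').ncard ≤ (A * B).ncard →
      A'.ncard < A.ncard → KneserIneq A' B') :
    KneserIneq A B := by
  classical
  obtain ⟨C, H, hC, hmin⟩ : ∃ C H, IsConvergent A B C H ∧
      ∀ C' H', IsConvergent A B C' H' → Nat.card H ≤ Nat.card H' := by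
    have hex : ∃ n C H, IsConvergent A B C H ∧ Nat.card H = n := by
      obtain ⟨C, H, h⟩ := exists_isConvergent hint hnot ih'
      exact ⟨_, C, H, h, rfl⟩
    obtain ⟨C, H, h, hn⟩ := Nat.find_spec hex
    refine ⟨C, H, h, fun C' H' h' => ?_⟩
    rw [hn]
    exact Nat.find_min' hex ⟨C', H', h', rfl⟩
  by_contra hcon
  rw [KneserIneq, not_le] at hcon
  have hUI := Set.ncard_union_add_ncard_inter A B
  have hCAB := Set.ncard_le_ncard hC.subset
  have hcard := hC.card
  have hUH : (A ∪ B).ncard ≤ ((A ∪ B) * (H : Set G)).ncard :=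
    Set.ncard_le_ncard (Set.subset_mul_left _ H.one_mem)
  -- `A * B` is not periodic under `H`
  obtain ⟨a, ha, b, hb, h, hh, hm⟩ : ∃ a ∈ A, ∃ b ∈ B, ∃ h ∈ H, a * b * h ∉ A * B := by
    by_contra! hper
    have hle : H ≤ stabilizer G (A * B) := by
      intro h hh
      apply mem_stabilizer_of_forall
      rintro _ ⟨a, ha, b, hb, rfl⟩
      have := hper a ha b hb h hh
      rwa [mul_comm h]
    have := Subgroup.card_le_of_le hle
    omega
  have hmH : a * b * h ∈ (a * b) • (H : Set G) := ⟨h, hh, rfl⟩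
  have hmH' : a * b * h ∈ (b * a) • (H : Set G) := by rwa [mul_comm b a]
  have haa : a ∈ a • (H : Set G) := by simp [mem_smul_subgroup, H.one_mem]
  have hbb : b ∈ b • (H : Set G) := by simp [mem_smul_subgroup, H.one_mem]
  set m := a * b * h with hmdef
  set A₁ := A ∩ a • (H : Set G) with hA₁
  set A₂ := A ∩ b • (H : Set G) with hA₂
  set B₁ := B ∩ b • (H : Set G) with hB₁
  set B₂ := B ∩ a • (H : Set G) with hB₂
  have hA₁n : A₁.Nonempty := ⟨a, ha, haa⟩
  have hB₁n : B₁.Nonempty := ⟨b, hb, hbb⟩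
  have small : ∀ {A' B' : Set G}, A' ⊆ A → B' ⊆ B → Disjoint C (A' * B') →
      C.ncard + (A' * B').ncard ≤ (A * B).ncard := by
    intro A' B' hA' hB' hd
    rw [← Set.ncard_union_eq hd]
    exact Set.ncard_le_ncard (Set.union_subset hC.subset (Set.mul_subset_mul hA' hB'))
  have hCpos : 0 < C.ncard := (Set.ncard_pos).2 hC.nonempty
  obtain ⟨hd₁, hle₁, hlt₁⟩ := hC.lt_of_minimal hmin hm hmH (A' := A₁) (B' := B₁)
    subset_rfl subset_rfl hA₁n hB₁n
  have hs₁ := small (A' := A₁) (B' := B₁) Set.inter_subset_left Set.inter_subset_left hd₁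
  have hper₁ := kneserIneq_periodic hA₁n hB₁n (show _ < (A * B).ncard by omega) ih
  -- Such a coset would have so many holes that `hper₁` contradicts `hlt₁`. Applied to `bH` and
  -- `aH`, this shows that the second pair `A₂`, `B₂` is nonempty and that the two cosets differ.
  have union_le : ∀ x ∈ A ∪ B, (A ∪ B) ∩ x • (H : Set G) ⊆ A₁ ∪ B₁ → False := by
    intro x hx hsub
    have h1 := card_le_ncard_mul_sub hx hle₁ hsub
    have h2 := Set.ncard_union_le (A₁ * (stabilizer G (A₁ * B₁) : Set G))
      (B₁ * (stabilizer G (A₁ * B₁) : Set G))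
    rw [← Set.union_mul] at h2
    omega
  have hA₂₁ : ¬ A₂ ⊆ A₁ := by
    intro hsub
    refine union_le b (Or.inr hb) ?_
    rintro z ⟨hz | hz, hz'⟩
    · exact Or.inl (hsub ⟨hz, hz'⟩)
    · exact Or.inr ⟨hz, hz'⟩
  have hB₂₁ : ¬ B₂ ⊆ B₁ := by
    intro hsub
    refine union_le a (Or.inl ha) ?_
    rintro z ⟨hz | hz, hz'⟩
    · exact Or.inl ⟨hz, hz'⟩
    · exact Or.inr (hsub ⟨hz, hz'⟩)
  have hA₂n : A₂.Nonempty := by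
    by_contra hne
    rw [Set.not_nonempty_iff_eq_empty] at hne
    exact hA₂₁ (hne ▸ Set.empty_subset _)
  have hB₂n : B₂.Nonempty := by
    by_contra hne
    rw [Set.not_nonempty_iff_eq_empty] at hne
    exact hB₂₁ (hne ▸ Set.empty_subset _)
  have hcos : Disjoint (a • (H : Set G)) (b • (H : Set G)) := by
    rw [Set.disjoint_left]
    intro z hza hzb
    have : a • (H : Set G) = b • (H : Set G) :=
      (smul_subgroup_eq_of_mem hza).symm.trans (smul_subgroup_eq_of_mem hzb)
    apply hA₂₁
    rw [hA₂, hA₁, this]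
  obtain ⟨hd₂, hle₂, hlt₂⟩ := hC.lt_of_minimal hmin hm hmH' (A' := A₂) (B' := B₂)
    subset_rfl subset_rfl hA₂n hB₂n
  have hs₂ := small (A' := A₂) (B' := B₂) Set.inter_subset_left Set.inter_subset_left hd₂
  have hk₁ := ih A₁ B₁ hA₁n hB₁n (by omega)
  have hk₂ := ih A₂ B₂ hA₂n hB₂n (by omega)
  rw [KneserIneq] at hk₁ hk₂
  -- Both `|D|` and `|H|` are multiples of the order of the stabilizer of `D`, so a strict
  -- inequality gains a full multiple.
  have gap : ∀ {D : Set G}, stabilizer G D ≤ H →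
      D.ncard + Nat.card (stabilizer G D) + ((A ∪ B) * (H : Set G)).ncard <
        Nat.card H + ((A ∪ B) * (stabilizer G D : Set G)).ncard →
      D.ncard + 2 * Nat.card (stabilizer G D) ≤ Nat.card H := by
    intro D hle hlt
    have h1 := Set.ncard_le_ncard (Set.mul_subset_mul_left (s := A ∪ B) hle)
    obtain ⟨u, hu⟩ := card_dvd_ncard_of_le_stabilizer (le_refl (stabilizer G D))
    obtain ⟨v, hv⟩ := Subgroup.card_dvd_of_le hle
    have h2 : D.ncard + Nat.card (stabilizer G D) < Nat.card H := by
      have : ((A ∪ B) * (stabilizer G D : Set G)).ncard ≤ ((A ∪ B) * (H : Set G)).ncard := h1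
      omega
    rw [hu, hv] at h2 ⊢
    have : u + 1 < v := by
      by_contra hge
      have := Nat.mul_le_mul_left (Nat.card (stabilizer G D)) (not_lt.1 hge)
      rw [mul_add] at this
      omega
    calc _ = Nat.card (stabilizer G D) * (u + 2) := by ring
      _ ≤ _ := Nat.mul_le_mul_left _ this
  have hg₁ := gap hle₁ hlt₁
  have hg₂ := gap hle₂ hlt₂
  set S := a • (H : Set G) \ (A ∪ B) with hS
  set T := b • (H : Set G) \ (A ∪ B) with hT
  have hUsub : A ∪ B ⊆ (A ∪ B) * (H : Set G) := Set.subset_mul_left _ H.one_mem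
  have hST : S.ncard + T.ncard + (A ∪ B).ncard ≤ ((A ∪ B) * (H : Set G)).ncard := by
    rw [← Set.ncard_union_eq (hcos.mono Set.sdiff_subset Set.sdiff_subset),
      ← Set.ncard_union_eq (Set.disjoint_left.2 (by rintro z (hz | hz) <;> exact hz.2))]
    refine Set.ncard_le_ncard ?_
    refine Set.union_subset (Set.union_subset ?_ ?_) hUsub
    · rintro _ ⟨⟨g, hg, rfl⟩, -⟩
      exact ⟨a, Or.inl ha, g, hg, rfl⟩
    · rintro _ ⟨⟨g, hg, rfl⟩, -⟩
      exact ⟨b, Or.inr hb, g, hg, rfl⟩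
  have hSle : Nat.card H ≤ S.ncard + (A₁.ncard + B₂.ncard) := by
    rw [← ncard_smul_subgroup a H]
    calc _ ≤ (S ∪ (A₁ ∪ B₂)).ncard := by
          refine Set.ncard_le_ncard (fun z hz => ?_)
          by_cases hzA : z ∈ A
          · exact Or.inr (Or.inl ⟨hzA, hz⟩)
          by_cases hzB : z ∈ B
          · exact Or.inr (Or.inr ⟨hzB, hz⟩)
          exact Or.inl ⟨hz, fun h => h.elim hzA hzB⟩
      _ ≤ _ := (Set.ncard_union_le _ _).trans (Nat.add_le_add_left (Set.ncard_union_le _ _) _)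
  have hTle : Nat.card H ≤ T.ncard + (A₂.ncard + B₁.ncard) := by
    rw [← ncard_smul_subgroup b H]
    calc _ ≤ (T ∪ (A₂ ∪ B₁)).ncard := by
          refine Set.ncard_le_ncard (fun z hz => ?_)
          by_cases hzA : z ∈ A
          · exact Or.inr (Or.inl ⟨hzA, hz⟩)
          by_cases hzB : z ∈ B
          · exact Or.inr (Or.inr ⟨hzB, hz⟩)
          exact Or.inl ⟨hz, fun h => h.elim hzA hzB⟩
      _ ≤ _ := (Set.ncard_union_le _ _).trans (Nat.add_le_add_left (Set.ncard_union_le _ _) _)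
  -- Failure of Kneser's inequality and the size of `C` give `|S| + |T| + |A_i B_i| < |H|` for `i =
  -- 1, 2`. Adding `hg₁` and `hg₂` and halving contradicts `hSle + hTle` combined with `hk₁`, `hk₂`.
  omega

/-- **Kneser's theorem** in a finite commutative group. -/
theorem kneserIneq {A B : Set G} (hA : A.Nonempty) (hB : B.Nonempty) : KneserIneq A B := by
  -- Lexicographic induction on `(|A * B|, |A|)`.
  suffices H : ∀ n k : ℕ, ∀ A B : Set G, A.Nonempty → B.Nonempty → (A * B).ncard = n →
      A.ncard = k → KneserIneq A B from H _ _ A B hA hB rfl rfl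
  intro n
  induction n using Nat.strong_induction_on with | _ n ihn =>
  intro k
  induction k using Nat.strong_induction_on with | _ k ihk =>
  intro A B hA hB hn hk
  by_cases hall : ∀ a ∈ A, ∀ a' ∈ A, ∀ b ∈ B, a' * a⁻¹ * b ∈ B
  · obtain ⟨a, ha⟩ := hA
    have h1 : A * B = a • B := by
      apply Set.Subset.antisymm
      · rintro _ ⟨a', ha', b, hb, rfl⟩
        refine ⟨_, hall a ha a' ha' b hb, ?_⟩
        change a * (a' * a⁻¹ * b) = a' * b
        simp only [mul_assoc, mul_left_comm a, inv_mul_cancel_left]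
      · rintro _ ⟨b, hb, rfl⟩
        exact ⟨a, ha, b, hb, rfl⟩
    have h2 : a⁻¹ • A ⊆ (stabilizer G (A * B) : Set G) := by
      rintro _ ⟨a', ha', rfl⟩
      have : a' * a⁻¹ ∈ stabilizer G B := mem_stabilizer_of_forall (hall a ha a' ha')
      have := stabilizer_le_stabilizer_mul B A this
      rw [mul_comm B A] at this
      simpa [mul_comm] using this
    have h3 := Set.ncard_le_ncard h2
    have h4 : Nat.card (stabilizer G (A * B)) = (stabilizer G (A * B) : Set G).ncard :=
      Nat.card_coe_set_eq _
    rw [KneserIneq, h4]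
    rw [Set.ncard_smul_set] at h3
    have h5 : (A * B).ncard = B.ncard := by rw [h1, Set.ncard_smul_set]
    omega
  -- Translating `B` by `a * b⁻¹` puts `a` into both sets and keeps `a'` out of the second, as
  -- `kneserIneq_of_inter` requires.
  · push Not at hall
    obtain ⟨a, ha, a', ha', b, hb, hab⟩ := hall
    have hmul : A * ((a * b⁻¹) • B) = (a * b⁻¹) • (A * B) := mul_smul_comm _ _ _
    have hcard : (A * ((a * b⁻¹) • B)).ncard = (A * B).ncard := by
      rw [hmul, Set.ncard_smul_set]
    have key : KneserIneq A ((a * b⁻¹) • B) := by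
      apply kneserIneq_of_inter
      · exact ⟨a, ha, b, hb, by simp⟩
      · intro hsub
        obtain ⟨b', hb', hbb⟩ := hsub ha'
        apply hab
        convert hb'
        rw [← hbb]
        change a * b⁻¹ * b' * a⁻¹ * b = b'
        rw [mul_right_comm _ a⁻¹ b, mul_inv_eq_iff_eq_mul, mul_right_comm a, mul_assoc _ b⁻¹,
          inv_mul_cancel, mul_one, mul_comm]
      · intro A' B' hA' hB' hlt
        exact ihn _ (by omega) _ A' B' hA' hB' rfl rfl
      · intro A' B' hA' hB' hle hlt
        rcases hle.lt_or_eq with h | h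
        · exact ihn _ (by omega) _ A' B' hA' hB' rfl rfl
        · exact ihk _ (by omega) A' B' hA' hB' (by omega) rfl
    have hst : stabilizer G ((a * b⁻¹) • (A * B)) = stabilizer G (A * B) := by
      rw [stabilizer_smul_eq_right]
    rw [KneserIneq, hcard, hmul, hst, Set.ncard_smul_set] at key
    exact key

/-- Kneser's theorem for a finite product of sets, all taken modulo the stabilizer `H` of a product
with possibly more factors. -/
theorem kneser_prod {ι : Type*} (A : ι → Set G) (hA : ∀ i, (A i).Nonempty) (t s : Finset ι)
    (hts : t ⊆ s) (H : Subgroup G) (hH : H = stabilizer G (∏ i ∈ s, A i)) :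
    ∑ i ∈ t, (A i * (H : Set G)).ncard + Nat.card H ≤
      ((H : Set G) * ∏ i ∈ t, A i).ncard + t.card * Nat.card H := by
  classical
  induction t using Finset.induction_on with
  | empty => simp [← Nat.card_coe_set_eq]
  | insert i t hi ih =>
    have ih := ih ((Finset.subset_insert i t).trans hts)
    have hHn : (H : Set G).Nonempty := ⟨1, H.one_mem⟩
    have hne : ∀ u : Finset ι, (∏ j ∈ u, A j).Nonempty := by
      intro u
      induction u using Finset.induction_on with
      | empty => simp
      | insert j u hj ihu => rw [Finset.prod_insert hj]; exact (hA j).mul ihu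
    have hk := kneserIneq (A := A i * (H : Set G)) (B := (H : Set G) * ∏ j ∈ t, A j)
      ((hA i).mul hHn) (hHn.mul (hne t))
    have hprod : (A i * (H : Set G)) * ((H : Set G) * ∏ j ∈ t, A j) =
        (H : Set G) * ∏ j ∈ insert i t, A j := by
      rw [Finset.prod_insert hi]
      rw [mul_assoc, ← mul_assoc (H : Set G) (H : Set G), coe_mul_coe H, mul_left_comm]
    rw [KneserIneq, hprod] at hk
    -- A period of the partial product remains one after the missing factors are multiplied in, and
    -- the full product has stabilizer `H`.
    have hle : stabilizer G ((H : Set G) * ∏ j ∈ insert i t, A j) ≤ H := by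
      have h1 := stabilizer_le_stabilizer_mul ((H : Set G) * ∏ j ∈ insert i t, A j)
        (∏ j ∈ s \ insert i t, A j)
      rw [mul_assoc, mul_comm (∏ j ∈ insert i t, A j), Finset.prod_sdiff hts] at h1
      refine h1.trans ?_
      rw [hH, stabilizer_mul_self]
    have := Subgroup.card_le_of_le hle
    rw [Finset.sum_insert hi, Finset.card_insert_of_notMem hi, add_mul, one_mul]
    omega

end Kneser

/-! ### Receivers as matchings between layer 2 and layer 4 -/

section Flow

theorem MultiDigraph.IsPath.inv {V E : Type} {G : MultiDigraph V E} {a b : V} {p : List E}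
    (h : G.IsPath a b p) :
    (∃ e, p = [e] ∧ G.tail e = a ∧ G.head e = b) ∨
      ∃ e p', p = e :: p' ∧ G.tail e = a ∧ G.IsPath (G.head e) b p' := by
  cases h with
  | single e => exact Or.inl ⟨e, rfl, rfl, rfl⟩
  | cons e h => exact Or.inr ⟨e, _, rfl, rfl, h⟩

variable {ω : ℕ} {d : Fin ω → ℕ}

theorem not_isPath_from_grey {y : GreyIndex ω d} {b : UpperNode ω d} {p : List (UpperEdge ω d)} :
    ¬ (upperGraph ω d).IsPath (grey ω d y) b p := by
  intro h
  rcases h.inv with ⟨e, -, he, -⟩ | ⟨e, p', -, he, -⟩ <;>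
    cases e <;> simp [upperGraph, UpperEdge.tail, grey] at he

theorem isPath_from_v {i : Fin ω} {x : GreyIndex ω d} {p : List (UpperEdge ω d)}
    (h : (upperGraph ω d).IsPath (.v i) (grey ω d x) p) :
    i = x.1 ∧ UpperEdge.vn x.1 x.2 ∈ p := by
  rcases h.inv with ⟨e, rfl, he, he'⟩ | ⟨e, p', rfl, he, h'⟩
  · cases e with
    | vn i' j' =>
      simp only [upperGraph, UpperEdge.tail, UpperNode.v.injEq] at he
      simp only [upperGraph, UpperEdge.head, grey, UpperNode.n.injEq] at he'
      obtain ⟨rfl, h2⟩ := he'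
      obtain rfl := eq_of_heq h2
      exact ⟨he.symm, by simp⟩
    | _ => simp [upperGraph, UpperEdge.tail] at he
  · cases e with
    | vn i' j' => exact absurd h' (not_isPath_from_grey (y := ⟨i', j'⟩))
    | _ => simp [upperGraph, UpperEdge.tail] at he

theorem isPath_from_u {l : Fin ω} {x : GreyIndex ω d} {p : List (UpperEdge ω d)}
    (h : (upperGraph ω d).IsPath (.u l) (grey ω d x) p) :
    (l = x.1 ∨ l = cyclicPred x.1) ∧ UpperEdge.vn x.1 x.2 ∈ p := by
  rcases h.inv with ⟨e, rfl, he, he'⟩ | ⟨e, p', rfl, he, h'⟩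
  · cases e <;> simp [upperGraph, UpperEdge.tail, UpperEdge.head, grey] at he he'
  · cases e with
    | uv i =>
      simp only [upperGraph, UpperEdge.tail, UpperNode.u.injEq] at he
      obtain ⟨h1, h2⟩ := isPath_from_v h'
      exact ⟨Or.inl (he.symm.trans h1), List.mem_cons_of_mem _ h2⟩
    | uv' i =>
      simp only [upperGraph, UpperEdge.tail, UpperNode.u.injEq] at he
      obtain ⟨h1, h2⟩ := isPath_from_v h'
      exact ⟨Or.inr (by rw [← he, h1]), List.mem_cons_of_mem _ h2⟩
    | _ => simp [upperGraph, UpperEdge.tail] at he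

theorem isPath_from_s {x : GreyIndex ω d} {p : List (UpperEdge ω d)}
    (h : (upperGraph ω d).IsPath .s (grey ω d x) p) :
    ∃ l, UpperEdge.su l ∈ p ∧ (l = x.1 ∨ l = cyclicPred x.1) ∧ UpperEdge.vn x.1 x.2 ∈ p := by
  rcases h.inv with ⟨e, rfl, he, he'⟩ | ⟨e, p', rfl, he, h'⟩
  · cases e <;> simp [upperGraph, UpperEdge.tail, UpperEdge.head, grey] at he he'
  · cases e with
    | su l =>
      obtain ⟨h1, h2⟩ := isPath_from_u h'
      exact ⟨l, List.mem_cons_self, h1, List.mem_cons_of_mem _ h2⟩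
    | _ => simp [upperGraph, UpperEdge.tail] at he

/-- Disjoint paths to layer-4 nodes leave the source through different layer-2 nodes and end at
different layer-4 nodes. -/
theorem hasDisjointPaths_grey {S : Set (GreyIndex ω d)} {m : ℕ}
    (h : (upperGraph ω d).HasDisjointPaths .s (grey ω d '' S) m) :
    ∃ (u : Fin m → Fin ω) (x : Fin m → GreyIndex ω d), Function.Injective u ∧
      Function.Injective x ∧ ∀ i, x i ∈ S ∧ (u i = (x i).1 ∨ u i = cyclicPred (x i).1) := by
  obtain ⟨P, hP, hdisj⟩ := h
  have key : ∀ i, ∃ l, ∃ y ∈ S, UpperEdge.su l ∈ P i ∧ (l = y.1 ∨ l = cyclicPred y.1) ∧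
      UpperEdge.vn y.1 y.2 ∈ P i := by
    intro i
    obtain ⟨_, ⟨y, hy, rfl⟩, hp⟩ := hP i
    obtain ⟨l, h1, h2, h3⟩ := isPath_from_s hp
    exact ⟨l, y, hy, h1, h2, h3⟩
  choose u x hx hu hux hvn using key
  refine ⟨u, x, ?_, ?_, fun i => ⟨hx i, hux i⟩⟩
  · intro i j hij
    by_contra hne
    exact hdisj i j hne (hu i) (hij ▸ hu j)
  · intro i j hij
    by_contra hne
    exact hdisj i j hne (hvn i) (hij ▸ hvn j)

theorem bddAbove_disjointPaths (S : Set (GreyIndex ω d)) :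
    BddAbove {m | (upperGraph ω d).HasDisjointPaths .s (grey ω d '' S) m} := by
  refine ⟨ω, fun m hm => ?_⟩
  obtain ⟨u, -, hu, -⟩ := hasDisjointPaths_grey hm
  simpa using Fintype.card_le_of_injective u hu

/-- If the maximum flow is `ω`, every layer-2 node reaches a layer-4 node of its own. -/
theorem exists_matching_of_maxflow {S : Set (GreyIndex ω d)}
    (h : (upperGraph ω d).maxflow .s (grey ω d '' S) = ω) :
    ∃ x : Fin ω → GreyIndex ω d, Function.Injective x ∧
      ∀ l, x l ∈ S ∧ (l = (x l).1 ∨ l = cyclicPred (x l).1) := by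
  have hmem : (upperGraph ω d).maxflow .s (grey ω d '' S) ∈
      {m | (upperGraph ω d).HasDisjointPaths .s (grey ω d '' S) m} :=
    Nat.sSup_mem ⟨0, Fin.elim0, fun i => i.elim0, fun i => i.elim0⟩ (bddAbove_disjointPaths S)
  rw [h] at hmem
  obtain ⟨u, x, hu, hx, hux⟩ := hasDisjointPaths_grey hmem
  have hbij : Function.Bijective u := Finite.injective_iff_bijective.1 hu
  let e := Equiv.ofBijective u hbij
  refine ⟨x ∘ e.symm, hx.comp e.symm.injective, fun l => ⟨(hux _).1, ?_⟩⟩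
  have : u (e.symm l) = l := e.apply_symm_apply l
  simpa [this] using (hux (e.symm l)).2

/-- The path from the source through `u l` to the layer-4 node `x`. -/
def pathThrough (l : Fin ω) (x : GreyIndex ω d) : List (UpperEdge ω d) :=
  [.su l, if l = x.1 then .uv x.1 else .uv' x.1, .vn x.1 x.2]

theorem isPath_pathThrough {l : Fin ω} {x : GreyIndex ω d}
    (h : l = x.1 ∨ l = cyclicPred x.1) :
    (upperGraph ω d).IsPath .s (grey ω d x) (pathThrough l x) := by
  have h3 : (upperGraph ω d).IsPath (.v x.1) (grey ω d x) [.vn x.1 x.2] :=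
    MultiDigraph.IsPath.single (G := upperGraph ω d) (UpperEdge.vn x.1 x.2)
  by_cases hl : l = x.1
  · have h2 := MultiDigraph.IsPath.cons (G := upperGraph ω d) (UpperEdge.uv x.1) h3
    have h1 := MultiDigraph.IsPath.cons (G := upperGraph ω d) (UpperEdge.su x.1) h2
    rw [pathThrough, if_pos hl, hl]
    exact h1
  · have hl' := h.resolve_left hl
    have h2 := MultiDigraph.IsPath.cons (G := upperGraph ω d) (UpperEdge.uv' x.1) h3
    have h1 := MultiDigraph.IsPath.cons (G := upperGraph ω d) (UpperEdge.su (cyclicPred x.1)) h2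
    rw [pathThrough, if_neg hl, hl']
    exact h1

/-- Converse of `exists_matching_of_maxflow`: the paths through distinct layer-2 nodes to distinct
layer-4 nodes share no edge. -/
theorem maxflow_of_matching {x : Fin ω → GreyIndex ω d} (hx : Function.Injective x)
    (hadj : ∀ l, l = (x l).1 ∨ l = cyclicPred (x l).1) {S : Set (GreyIndex ω d)}
    (hS : ∀ l, x l ∈ S) :
    (upperGraph ω d).maxflow .s (grey ω d '' S) = ω := by
  apply le_antisymm
  · refine csSup_le ⟨0, Fin.elim0, fun i => i.elim0, fun i => i.elim0⟩ fun m hm => ?_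
    obtain ⟨u, -, hu, -⟩ := hasDisjointPaths_grey hm
    simpa using Fintype.card_le_of_injective u hu
  · refine le_csSup (bddAbove_disjointPaths S) ⟨fun l => pathThrough l (x l), fun l =>
      ⟨_, ⟨x l, hS l, rfl⟩, isPath_pathThrough (hadj l)⟩, fun l l' hne => ?_⟩
    have hxne : x l ≠ x l' := fun h => hne (hx h)
    have hvn : UpperEdge.vn (x l).1 (x l).2 ≠ UpperEdge.vn (x l').1 (x l').2 := by
      intro h
      simp only [UpperEdge.vn.injEq] at h
      exact hxne (Sigma.ext h.1 h.2)
    have hmid : (if l = (x l).1 then UpperEdge.uv (x l).1 else .uv' (x l).1 : UpperEdge ω d) ≠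
        if l' = (x l').1 then UpperEdge.uv (x l').1 else .uv' (x l').1 := by
      split_ifs with h1 h2 h2
      · simpa [← h1, ← h2] using hne
      · simp
      · simp
      · intro h
        simp only [UpperEdge.uv'.injEq] at h
        apply hne
        rw [(hadj l).resolve_left h1, (hadj l').resolve_left h2, h]
    simp only [pathThrough, List.disjoint_left, List.mem_cons, List.not_mem_nil, or_false]
    rintro e (rfl | rfl | rfl) (h | h | h)
    · exact hne (by simpa using h)
    · split_ifs at h
    · simp at h
    · split_ifs at h
    · exact hmid h
    · split_ifs at h
    · simp at h
    · split_ifs at h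
    · exact hvn h

/-- The receiver below the layer-4 nodes `x 0, …, x (ω - 1)`. -/
def receiverOfMatching (x : Fin ω → GreyIndex ω d) (hx : Function.Injective x)
    (hadj : ∀ l, l = (x l).1 ∨ l = cyclicPred (x l).1) : Receiver ω d :=
  ⟨Finset.univ.map ⟨x, hx⟩, by simp, maxflow_of_matching hx hadj (by simp)⟩

theorem mem_receiverOfMatching {x : Fin ω → GreyIndex ω d} {hx : Function.Injective x}
    {hadj : ∀ l, l = (x l).1 ∨ l = cyclicPred (x l).1} {y : GreyIndex ω d} :
    y ∈ (receiverOfMatching x hx hadj).1 ↔ ∃ l, x l = y := by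
  simp [receiverOfMatching]

end Flow

/-! ### Full row rank as a trivial left kernel -/

section Rank

theorem rank_eq_card_iff {m n F : Type*} [Finite m] [Fintype n] [Field F] (M : Matrix m n F) :
    M.rank = Nat.card m ↔
      ∀ w : m → F, (∀ e, ∑ᶠ o, w o * M o e = 0) → w = 0 := by
  have := Fintype.ofFinite m
  have h1 : M.rank = Nat.card m ↔ LinearIndependent F M.row := by
    rw [linearIndependent_iff_card_eq_finrank_span, Matrix.rank_eq_finrank_span_row,
      Nat.card_eq_fintype_card, eq_comm]
    rfl
  rw [h1, ← Matrix.vecMul_injective_iff]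
  change Function.Injective M.vecMulLinear ↔ _
  rw [injective_iff_map_eq_zero]
  refine forall_congr' fun w => imp_congr_left ?_
  simp only [Matrix.vecMulLinear_apply, funext_iff, Pi.zero_apply, Matrix.vecMul, dotProduct,
    finsum_eq_sum_of_fintype]

end Rank

/-! ### Codes reduced to two coefficients per layer-4 node -/

section Codes

theorem Network.IsCode.sum_smul {N : Network} {F : Type*} [Field F] {c : N.E → N.E → F}
    (hc : N.IsCode c) (e : N.E) {M : Type*} [AddCommMonoid M] [Module F M] (g : N.E → M)
    (s : Finset N.E) (hs : ∀ a, N.graph.head a = N.graph.tail e → a ∈ s) :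
    ∑ a, c a e • g a = ∑ a ∈ s, c a e • g a := by
  symm
  refine Finset.sum_subset (Finset.subset_univ _) fun a _ ha => ?_
  rw [hc a e (fun h => ha (hs a h)), zero_smul]

variable {ω : ℕ} {d : Fin ω → ℕ}

/-- The outgoing edge of the source that leads to `u l`. -/
def outEdge (l : Fin ω) : (layeredNetwork ω d).Out := ⟨.inl (.su l), rfl⟩

theorem outEdge_bijective : Function.Bijective (outEdge (ω := ω) (d := d)) := by
  constructor
  · intro l l' h
    have : (Sum.inl (.su l) : FullEdge ω d) = .inl (.su l') := congrArg Subtype.val h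
    simpa using this
  · rintro ⟨e | ⟨N, x⟩, he⟩
    · cases e with
      | su l => exact ⟨l, rfl⟩
      | _ => simp [layeredNetwork, fullGraph, UpperEdge.tail] at he
    · simp [layeredNetwork, fullGraph, grey] at he

/-- The outgoing edges of the source are indexed by the layer-2 nodes. -/
noncomputable def outEquiv : Fin ω ≃ (layeredNetwork ω d).Out :=
  Equiv.ofBijective _ outEdge_bijective

theorem outEquiv_symm_outEdge (l : Fin ω) :
    (outEquiv (d := d)).symm (outEdge l) = l :=
  outEquiv.symm_apply_apply l

theorem finsum_out {F : Type*} [AddCommMonoid F] (g : (layeredNetwork ω d).Out → F) :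
    ∑ᶠ o, g o = ∑ l, g (outEdge l) := by
  rw [← finsum_comp_equiv outEquiv,
    finsum_eq_sum_of_fintype]
  rfl

variable {F : Type*} [Field F] {c : (layeredNetwork ω d).E → (layeredNetwork ω d).E → F}
  {M : Type*} [AddCommMonoid M] [Module F M]

theorem sum_uv (hc : (layeredNetwork ω d).IsCode c) (g : (layeredNetwork ω d).E → M)
    (i : Fin ω) :
    ∑ a, c a (.inl (.uv i)) • g a = c (.inl (.su i)) (.inl (.uv i)) • g (.inl (.su i)) := by
  classical
  refine (hc.sum_smul (.inl (.uv i) : FullEdge ω d) g {(.inl (.su i) : FullEdge ω d)} ?_).trans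
    (Finset.sum_singleton _ _)
  rintro (e | ⟨N, x⟩) he
  · cases e with
    | su l =>
      obtain rfl : l = i := by
        simpa [layeredNetwork, fullGraph, UpperEdge.head, UpperEdge.tail] using he
      exact Finset.mem_singleton_self _
    | _ => simp [layeredNetwork, fullGraph, UpperEdge.head, UpperEdge.tail] at he
  · simp [layeredNetwork, fullGraph] at he

theorem sum_uv' (hc : (layeredNetwork ω d).IsCode c) (g : (layeredNetwork ω d).E → M)
    (i : Fin ω) :
    ∑ a, c a (.inl (.uv' i)) • g a =
      c (.inl (.su (cyclicPred i))) (.inl (.uv' i)) • g (.inl (.su (cyclicPred i))) := by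
  classical
  refine (hc.sum_smul (.inl (.uv' i) : FullEdge ω d) g {(.inl (.su (cyclicPred i)) : FullEdge ω d)} ?_).trans
    (Finset.sum_singleton _ _)
  rintro (e | ⟨N, x⟩) he
  · cases e with
    | su l =>
      obtain rfl : l = cyclicPred i := by
        simpa [layeredNetwork, fullGraph, UpperEdge.head, UpperEdge.tail] using he
      exact Finset.mem_singleton_self _
    | _ => simp [layeredNetwork, fullGraph, UpperEdge.head, UpperEdge.tail] at he
  · simp [layeredNetwork, fullGraph] at he

theorem sum_vn (hc : (layeredNetwork ω d).IsCode c) (g : (layeredNetwork ω d).E → M)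
    (i : Fin ω) (j : Fin (d i)) :
    ∑ a, c a (.inl (.vn i j)) • g a =
      c (.inl (.uv i)) (.inl (.vn i j)) • g (.inl (.uv i)) +
      c (.inl (.uv' i)) (.inl (.vn i j)) • g (.inl (.uv' i)) := by
  classical
  refine (hc.sum_smul (.inl (.vn i j) : FullEdge ω d) g
    {(.inl (.uv i) : FullEdge ω d), .inl (.uv' i)} ?_).trans (Finset.sum_pair fun h => ?_)
  swap
  · have h' : (Sum.inl (.uv i) : FullEdge ω d) = .inl (.uv' i) := h
    simp at h'
  rintro (e | ⟨N, x⟩) he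
  · cases e with
    | uv l =>
      obtain rfl : l = i := by
        simpa [layeredNetwork, fullGraph, UpperEdge.head, UpperEdge.tail] using he
      exact Finset.mem_insert_self _ _
    | uv' l =>
      obtain rfl : l = i := by
        simpa [layeredNetwork, fullGraph, UpperEdge.head, UpperEdge.tail] using he
      exact Finset.mem_insert_of_mem (Finset.mem_singleton_self _)
    | _ => simp [layeredNetwork, fullGraph, UpperEdge.head, UpperEdge.tail] at he
  · simp [layeredNetwork, fullGraph] at he

theorem sum_receiver (hc : (layeredNetwork ω d).IsCode c) (g : (layeredNetwork ω d).E → M)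
    (N : Receiver ω d) (x : {x : GreyIndex ω d // x ∈ N.1}) :
    ∑ a, c a (.inr ⟨N, x⟩) • g a =
      c (.inl (.vn x.1.1 x.1.2)) (.inr ⟨N, x⟩) • g (.inl (.vn x.1.1 x.1.2)) := by
  classical
  refine (hc.sum_smul (.inr ⟨N, x⟩ : FullEdge ω d) g {(.inl (.vn x.1.1 x.1.2) : FullEdge ω d)}
    ?_).trans (Finset.sum_singleton _ _)
  rintro (e | ⟨N', x'⟩) he
  · cases e with
    | vn i j =>
      simp only [layeredNetwork, fullGraph, UpperEdge.head, grey, Sum.inl.injEq,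
        UpperNode.n.injEq] at he
      obtain ⟨rfl, h2⟩ := he
      obtain rfl := eq_of_heq h2
      exact Finset.mem_singleton_self _
    | _ => simp [layeredNetwork, fullGraph, UpperEdge.head, grey] at he
  · simp [layeredNetwork, fullGraph] at he

/-- The layer-4 nodes carry the vectors `α x e_i + β x e_{i-1}`, and the vectors received are
multiples of these; if they have full rank, no nonzero functional `w` vanishes on all of them. -/
theorem exists_coefficients_of_linearlySolvable
    (h : (layeredNetwork ω d).LinearlySolvable F) :
    ∃ α β : GreyIndex ω d → F, ∀ N : Receiver ω d, ∀ w : Fin ω → F,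
      (∀ x ∈ N.1, α x * w x.1 + β x * w (cyclicPred x.1) = 0) → w = 0 := by
  classical
  obtain ⟨c, f, hc, ⟨hf₀, hf⟩, hrank⟩ := h
  refine ⟨fun x => c (.inl (.uv x.1)) (.inl (.vn x.1 x.2)) * c (.inl (.su x.1)) (.inl (.uv x.1)),
    fun x => c (.inl (.uv' x.1)) (.inl (.vn x.1 x.2)) *
      c (.inl (.su (cyclicPred x.1))) (.inl (.uv' x.1)), fun N w hw => ?_⟩
  have hr := hrank (.inr N) ⟨N, rfl⟩
  rw [Network.dim, rank_eq_card_iff] at hr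
  let φ : ((layeredNetwork ω d).Out → F) →ₗ[F] F :=
    { toFun := fun v => ∑ l, w l * v (outEdge l)
      map_add' := fun v v' => by simp [mul_add, Finset.sum_add_distrib]
      map_smul' := fun a v => by simp [Finset.mul_sum, mul_left_comm] }
  have hsu : ∀ l, φ (f (.inl (.su l))) = w l := by
    intro l
    have : f (.inl (.su l)) = Pi.single (outEdge l) 1 := hf₀ (outEdge l)
    rw [this]
    change ∑ l', w l' * (Pi.single (outEdge l) 1 : (layeredNetwork ω d).Out → F) (outEdge l') = _
    simp [Pi.single_apply, outEdge_bijective.1.eq_iff]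
  have huv : ∀ i, φ (f (.inl (.uv i))) = c (.inl (.su i)) (.inl (.uv i)) * w i := by
    intro i
    rw [hf (.inl (.uv i)) (by simp [layeredNetwork, fullGraph, UpperEdge.tail]), sum_uv hc,
      map_smul, hsu, smul_eq_mul]
  have huv' : ∀ i, φ (f (.inl (.uv' i))) =
      c (.inl (.su (cyclicPred i))) (.inl (.uv' i)) * w (cyclicPred i) := by
    intro i
    rw [hf (.inl (.uv' i)) (by simp [layeredNetwork, fullGraph, UpperEdge.tail]), sum_uv' hc,
      map_smul, hsu, smul_eq_mul]
  have hker : (fun o : (layeredNetwork ω d).Out => w (outEquiv.symm o)) = 0 := by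
    refine hr _ ?_
    rintro ⟨e, he⟩
    rw [finsum_out]
    rcases e with e | ⟨N', x⟩
    · simp [layeredNetwork, fullGraph] at he
    · obtain rfl : N' = N := by simpa [layeredNetwork, fullGraph] using he
      have h1 : φ (f (.inr ⟨N', x⟩)) = 0 := by
        rw [hf (.inr ⟨N', x⟩) (by simp [layeredNetwork, fullGraph, grey]), sum_receiver hc,
          map_smul, hf (.inl (.vn x.1.1 x.1.2))
            (by simp [layeredNetwork, fullGraph, UpperEdge.tail]), sum_vn hc,
          map_add, map_smul, map_smul, huv, huv']
        have := hw x.1 x.2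
        simp only [smul_eq_mul]
        simp only [mul_assoc] at this
        rw [this, mul_zero]
      simp only [outEquiv_symm_outEdge, Matrix.of_apply]
      exact h1
  funext l
  have := congrFun hker (outEdge l)
  rwa [outEquiv_symm_outEdge] at this

/-- The coordinates of the coding vectors when the layer-4 nodes are to carry
`α x e_i + β x e_{i-1}`. -/
def codingCoord (α β : GreyIndex ω d → F) : FullEdge ω d → Fin ω → F
  | .inl (.su i) => Pi.single i 1
  | .inl (.uv i) => Pi.single i 1
  | .inl (.uv' i) => Pi.single (cyclicPred i) 1
  | .inl (.vn i j) => α ⟨i, j⟩ • Pi.single i 1 + β ⟨i, j⟩ • Pi.single (cyclicPred i) 1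
  | .inr ⟨_, x⟩ => α x.1 • Pi.single x.1.1 1 + β x.1 • Pi.single (cyclicPred x.1.1) 1

/-- The coding coefficients on adjacent pairs that produce `codingCoord α β`. -/
def codingCoeff (α β : GreyIndex ω d → F) : FullEdge ω d → FullEdge ω d → F
  | .inl (.uv _), .inl (.vn i j) => α ⟨i, j⟩
  | .inl (.uv' _), .inl (.vn i j) => β ⟨i, j⟩
  | _, _ => 1

theorem linearlySolvable_of_coefficients (α β : GreyIndex ω d → F)
    (h : ∀ N : Receiver ω d, ∀ w : Fin ω → F,
      (∀ x ∈ N.1, α x * w x.1 + β x * w (cyclicPred x.1) = 0) → w = 0) :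
    (layeredNetwork ω d).LinearlySolvable F := by
  classical
  let c : (layeredNetwork ω d).E → (layeredNetwork ω d).E → F := fun a e =>
    if (layeredNetwork ω d).graph.head a = (layeredNetwork ω d).graph.tail e then
      codingCoeff α β a e else 0
  have hc : (layeredNetwork ω d).IsCode c := fun a e hae => if_neg hae
  let η : Fin ω ≃ (layeredNetwork ω d).Out := outEquiv
  have hη : ∀ l, η.symm (outEdge l) = l := outEquiv_symm_outEdge
  let f : (layeredNetwork ω d).E → (layeredNetwork ω d).Out → F := fun e o =>
    codingCoord α β e (η.symm o)
  refine ⟨c, f, hc, ⟨?_, ?_⟩, ?_⟩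
  · intro o
    obtain ⟨l, rfl⟩ := η.surjective o
    funext o'
    obtain ⟨l', rfl⟩ := η.surjective o'
    have h1 : f (η l).1 (η l') = (Pi.single l 1 : Fin ω → F) l' := by
      change (Pi.single l 1 : Fin ω → F) (η.symm (η l')) = _
      rw [Equiv.symm_apply_apply]
    rw [h1]
    simp [Pi.single_apply]
  · rintro (e | ⟨N, x⟩) he
    · cases e with
      | su i => exact absurd rfl he
      | uv i =>
        rw [sum_uv hc]
        have : c (.inl (.su i)) (.inl (.uv i)) = 1 := if_pos rfl
        rw [this, one_smul]
        rfl
      | uv' i =>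
        rw [sum_uv' hc]
        have : c (.inl (.su (cyclicPred i))) (.inl (.uv' i)) = 1 := if_pos rfl
        rw [this, one_smul]
        rfl
      | vn i j =>
        rw [sum_vn hc]
        have h1 : c (.inl (.uv i)) (.inl (.vn i j)) = α ⟨i, j⟩ := if_pos rfl
        have h2 : c (.inl (.uv' i)) (.inl (.vn i j)) = β ⟨i, j⟩ := if_pos rfl
        rw [h1, h2]
        rfl
    · rw [sum_receiver hc]
      have : c (.inl (.vn x.1.1 x.1.2)) (.inr ⟨N, x⟩) = 1 := if_pos rfl
      rw [this, one_smul]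
      rfl
  · rintro _ ⟨N, rfl⟩
    rw [Network.dim, rank_eq_card_iff]
    intro w hw
    have h1 : (fun l => w (outEdge l)) = 0 := by
      refine h N _ fun x hx => ?_
      have h2 := hw ⟨.inr ⟨N, ⟨x, hx⟩⟩, rfl⟩
      rw [finsum_out] at h2
      have h3 : ∀ l, f (.inr ⟨N, ⟨x, hx⟩⟩) (outEdge l) =
          (α x • Pi.single x.1 1 + β x • Pi.single (cyclicPred x.1) 1 : Fin ω → F) l := by
        intro l
        change codingCoord α β _ (η.symm (outEdge l)) = _
        rw [hη]
        rfl
      simp only [Matrix.of_apply, h3, Pi.add_apply, Pi.smul_apply, smul_eq_mul, mul_add,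
        Finset.sum_add_distrib, Pi.single_apply, mul_ite, mul_one, mul_zero] at h2
      simpa [mul_comm] using h2
    funext o
    obtain ⟨l, rfl⟩ := outEdge_bijective.2 o
    exact congrFun h1 l

end Codes

/-! ### Cyclic indices and recurrences -/

section Cyclic

variable {n : ℕ}

theorem cyclicPred_cases (i : Fin (n + 1)) :
    (i.val = 0 ∧ (cyclicPred i).val = n) ∨ (cyclicPred i).val + 1 = i.val := by
  have h : finRotate (n + 1) (cyclicPred i) = i := Equiv.apply_symm_apply _ _
  generalize cyclicPred i = l at h
  subst h
  by_cases hl : l = Fin.last n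
  · left
    subst hl
    simp
  · right
    rw [coe_finRotate_of_ne_last hl]

theorem finRotate_cyclicPred {ω : ℕ} (i : Fin ω) : finRotate ω (cyclicPred i) = i :=
  Equiv.apply_symm_apply _ _

theorem cyclicPred_finRotate {ω : ℕ} (i : Fin ω) : cyclicPred (finRotate ω i) = i :=
  Equiv.symm_apply_apply _ _

theorem cyclicPred_ne {ω : ℕ} (hω : 3 ≤ ω) (i : Fin ω) : cyclicPred i ≠ i := by
  obtain ⟨n, rfl⟩ : ∃ n, ω = n + 1 := ⟨ω - 1, by omega⟩
  intro h
  have := congrArg Fin.val h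
  have := cyclicPred_cases i
  omega

theorem cyclicPred_cyclicPred_ne {ω : ℕ} (hω : 3 ≤ ω) (i : Fin ω) :
    cyclicPred (cyclicPred i) ≠ i := by
  obtain ⟨n, rfl⟩ : ∃ n, ω = n + 1 := ⟨ω - 1, by omega⟩
  intro h
  have := congrArg Fin.val h
  have := cyclicPred_cases i
  have := cyclicPred_cases (cyclicPred i)
  omega

theorem forall_mem_of_cyclicPred_closed {ω : ℕ} {Y : Set (Fin ω)} (hY : Y.Nonempty)
    (h : ∀ i ∈ Y, cyclicPred i ∈ Y) (l : Fin ω) : l ∈ Y := by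
  obtain ⟨n, rfl⟩ : ∃ n, ω = n + 1 := ⟨ω - 1, by have := l.isLt; omega⟩
  have down : ∀ m : ℕ, ∀ i ∈ Y, ∀ l : Fin (n + 1), l.val + m = i.val → l ∈ Y := by
    intro m
    induction m with
    | zero =>
      intro i hi l hl
      rwa [show l = i from Fin.ext (by omega)]
    | succ m ih =>
      intro i hi l hl
      refine ih _ (h i hi) l ?_
      have := cyclicPred_cases i
      omega
  obtain ⟨i, hi⟩ := hY
  have h0 : (0 : Fin (n + 1)) ∈ Y := down i.val i hi 0 (by simp)
  have hlast := h 0 h0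
  refine down (n - l.val) _ hlast l ?_
  have := cyclicPred_cases (0 : Fin (n + 1))
  have := l.isLt
  have : ((0 : Fin (n + 1)) : ℕ) = 0 := rfl
  omega

/-- A cyclic system of recurrences `w i = ρ i * w (i - 1)` whose coefficients have product `1` has
a nonzero solution. -/
theorem exists_cyclic_solution {ω : ℕ} (hω : 0 < ω) {F : Type*} [Field F] (ρ : Fin ω → F)
    (hρ : ∏ i, ρ i = 1) : ∃ w : Fin ω → F, w ≠ 0 ∧ ∀ i, w i = ρ i * w (cyclicPred i) := by
  obtain ⟨n, rfl⟩ : ∃ n, ω = n + 1 := ⟨ω - 1, by omega⟩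
  let ρ' : ℕ → F := fun m => ρ (Fin.ofNat (n + 1) m)
  have hρ' : ∀ i : Fin (n + 1), ρ' i.val = ρ i := fun i => by simp [ρ']
  have hall : ∏ m ∈ Finset.range (n + 1), ρ' m = 1 := by
    rw [← Fin.prod_univ_eq_prod_range]
    simpa only [hρ'] using hρ
  -- Partial products solve the recurrence; it closes up at index `0` because the last one, the full
  -- product, is `1`.
  refine ⟨fun i => ∏ m ∈ Finset.range (i.val + 1), ρ' m, ?_, fun i => ?_⟩
  · intro h
    have := congrFun h (Fin.last n)
    simp only [Fin.val_last, hall, Pi.zero_apply] at this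
    exact one_ne_zero this
  · rcases cyclicPred_cases i with ⟨h0, h1⟩ | h1
    · simp only [h1, hall, mul_one, h0, zero_add, Finset.prod_range_one]
      rw [← hρ' i, h0]
    · simp only [h1]
      rw [Finset.prod_range_succ, hρ', mul_comm]

end Cyclic

/-! ### Solvability as a condition on products of units -/

section Criterion

variable {ω : ℕ} {d : Fin ω → ℕ} {F : Type*} [Field F]

/-- Suppose a nonzero `w` is killed by a receiver. The ratios being units, each relation has both of
its coordinates zero or both nonzero, and by injectivity at most one node below each `v_i` meets the
support `Y` of `w`. So the matching injects `Y` into itself, hence onto, which makes `Y` closed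
under `cyclicPred` and thus everything. The receiver then contains a transversal, and multiplying
its recurrences around the cycle gives product `1`. -/
theorem linearlySolvable_of_ratios (r : ∀ i, Fin (d i) → Fˣ)
    (hr : ∀ i, Function.Injective (r i)) (hprod : ∀ j : ∀ i, Fin (d i), ∏ i, r i (j i) ≠ 1) :
    (layeredNetwork ω d).LinearlySolvable F := by
  refine linearlySolvable_of_coefficients (fun _ => 1) (fun x => -(r x.1 x.2 : F)) fun N w hw => ?_
  obtain ⟨x, hx, hxN⟩ := exists_matching_of_maxflow N.2.2
  have hrec : ∀ y ∈ N.1, w y.1 = r y.1 y.2 * w (cyclicPred y.1) := by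
    intro y hy
    linear_combination hw y hy
  have huniq : ∀ y ∈ N.1, ∀ z ∈ N.1, y.1 = z.1 → w y.1 ≠ 0 → y = z := by
    rintro ⟨i, j⟩ hy ⟨i', j'⟩ hz hyz hne
    obtain rfl : i = i' := hyz
    have h1 := hrec _ hy
    have h2 := hrec _ hz
    have h3 : w (cyclicPred i) ≠ 0 := by
      intro h
      rw [h, mul_zero] at h1
      exact hne h1
    have h4 := mul_right_cancel₀ h3 (h1.symm.trans h2)
    obtain rfl : j = j' := hr i (Units.ext h4)
    rfl
  by_contra hw0
  let Y : Set (Fin ω) := {l | w l ≠ 0}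
  have hYn : Y.Nonempty := Function.ne_iff.1 hw0
  have hYx : ∀ l ∈ Y, (x l).1 ∈ Y ∧ cyclicPred (x l).1 ∈ Y := by
    intro l hl
    have h1 := hrec (x l) (hxN l).1
    have h2 : w (x l).1 = 0 ↔ w (cyclicPred (x l).1) = 0 := by simp [h1]
    rcases (hxN l).2 with h | h
    · have h3 : w (x l).1 ≠ 0 := by rw [← h]; exact hl
      exact ⟨h3, fun h' => h3 (h2.2 h')⟩
    · have h3 : w (cyclicPred (x l).1) ≠ 0 := by rw [← h]; exact hl
      exact ⟨fun h' => h3 (h2.1 h'), h3⟩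
  have hsurj : Function.Surjective (fun l : Y => (⟨(x l.1).1, (hYx l.1 l.2).1⟩ : Y)) := by
    apply Finite.injective_iff_surjective.1
    intro l l' h
    have h1 : (x l.1).1 = (x l'.1).1 := congrArg Subtype.val h
    exact Subtype.ext (hx (huniq _ (hxN _).1 _ (hxN _).1 h1 (hYx l.1 l.2).1))
  have hclosed : ∀ i ∈ Y, cyclicPred i ∈ Y := by
    intro i hi
    obtain ⟨l, hl⟩ := hsurj ⟨i, hi⟩
    have : (x l.1).1 = i := congrArg Subtype.val hl
    rw [← this]
    exact (hYx l.1 l.2).2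
  have hall := forall_mem_of_cyclicPred_closed hYn hclosed
  have hj : ∀ i, ∃ j, (⟨i, j⟩ : GreyIndex ω d) ∈ N.1 := by
    intro i
    obtain ⟨l, hl⟩ := hsurj ⟨i, hall i⟩
    have h1 : (x l.1).1 = i := congrArg Subtype.val hl
    subst h1
    exact ⟨(x l.1).2, (hxN l.1).1⟩
  choose j hj using hj
  apply hprod j
  have h1 : ∏ i, w i = ((∏ i, r i (j i) : Fˣ) : F) * ∏ i, w i := by
    calc ∏ i, w i = ∏ i, ((r i (j i) : F) * w (cyclicPred i)) :=
          Finset.prod_congr rfl fun i _ => hrec _ (hj i)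
      _ = _ := by
        rw [Finset.prod_mul_distrib, Units.coe_prod]
        congr 1
        exact Equiv.prod_comp (finRotate ω).symm w
  have h2 : ∏ i, w i ≠ 0 := Finset.prod_ne_zero_iff.2 fun i _ => hall i
  exact Units.ext (mul_right_cancel₀ h2 (by rw [Units.val_one, one_mul]; exact h1.symm))

theorem injective_update_of_forall_ne {α β : Type*} [DecidableEq α] {f : α → β}
    (hf : Function.Injective f) {b : β} (hb : ∀ a, f a ≠ b) (a : α) :
    Function.Injective (Function.update f a b) := by
  intro x y h
  by_cases hx : x = a <;> by_cases hy : y = a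
  · rw [hx, hy]
  · subst hx
    rw [Function.update_self, Function.update_of_ne hy] at h
    exact absurd h.symm (hb y)
  · subst hy
    rw [Function.update_self, Function.update_of_ne hx] at h
    exact absurd h (hb x)
  · rw [Function.update_of_ne hx, Function.update_of_ne hy] at h
    exact hf h

theorem exists_receiver_transversal (sel : ∀ i, Fin (d i)) :
    ∃ N : Receiver ω d, ∀ y ∈ N.1, y = ⟨y.1, sel y.1⟩ := by
  refine ⟨receiverOfMatching (fun l => ⟨l, sel l⟩) (fun l l' h => congrArg Sigma.fst h)
    (fun l => Or.inl rfl), fun y hy => ?_⟩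
  obtain ⟨l, rfl⟩ := mem_receiverOfMatching.1 hy
  rfl

/-- A receiver below two of the nodes below `v i` and one below every other `v l` except
`v (i - 1)`. -/
theorem exists_receiver_without_pred (sel : ∀ i, Fin (d i)) (i : Fin ω) {j : Fin (d i)}
    (hj : sel i ≠ j) :
    ∃ N : Receiver ω d, ⟨i, j⟩ ∈ N.1 ∧ ∀ l, l ≠ cyclicPred i → ⟨l, sel l⟩ ∈ N.1 := by
  -- The identity matching, with `u (i - 1)` redirected to the second node below `v i`.
  have hinj := injective_update_of_forall_ne (f := fun l => (⟨l, sel l⟩ : GreyIndex ω d))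
    (fun l l' h => congrArg Sigma.fst h) (b := ⟨i, j⟩)
    (by rintro a h; obtain ⟨rfl, h2⟩ := Sigma.mk.inj_iff.1 h; exact hj (eq_of_heq h2))
    (cyclicPred i)
  refine ⟨receiverOfMatching _ hinj fun l => ?_, ?_, fun l hl => ?_⟩
  · by_cases hl : l = cyclicPred i
    · subst hl
      rw [Function.update_self]
      exact Or.inr rfl
    · rw [Function.update_of_ne hl]
      exact Or.inl rfl
  · exact mem_receiverOfMatching.2 ⟨cyclicPred i, Function.update_self ..⟩
  · exact mem_receiverOfMatching.2 ⟨l, Function.update_of_ne hl ..⟩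

/-- A receiver below two of the nodes below `v i` and one below every other `v l` except
`v (i + 1)`. -/
theorem exists_receiver_without_succ (sel : ∀ i, Fin (d i)) (i : Fin ω) {j : Fin (d i)}
    (hj : sel i ≠ j) :
    ∃ N : Receiver ω d, ⟨i, j⟩ ∈ N.1 ∧ ∀ l, cyclicPred l ≠ i → ⟨l, sel l⟩ ∈ N.1 := by
  -- The matching shifted by one, with `u i` redirected to the second node below `v i`.
  have hinj := injective_update_of_forall_ne
    (f := fun l => (⟨finRotate ω l, sel (finRotate ω l)⟩ : GreyIndex ω d))
    (fun l l' h => (finRotate ω).injective (congrArg Sigma.fst h)) (b := ⟨i, j⟩)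
    (by
      rintro a h
      generalize finRotate ω a = b at h
      obtain ⟨rfl, h2⟩ := Sigma.mk.inj_iff.1 h
      exact hj (eq_of_heq h2)) i
  refine ⟨receiverOfMatching _ hinj fun l => ?_, ?_, fun l hl => ?_⟩
  · by_cases hl : l = i
    · subst hl
      rw [Function.update_self]
      exact Or.inl rfl
    · rw [Function.update_of_ne hl]
      exact Or.inr (cyclicPred_finRotate l).symm
  · exact mem_receiverOfMatching.2 ⟨i, Function.update_self ..⟩
  · refine mem_receiverOfMatching.2 ⟨cyclicPred l, ?_⟩
    rw [Function.update_of_ne hl, finRotate_cyclicPred]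

theorem exists_solution_of_receiver {α β : GreyIndex ω d → F} {N : Receiver ω d}
    (h : ∀ w : Fin ω → F,
      (∀ x ∈ N.1, α x * w x.1 + β x * w (cyclicPred x.1) = 0) → w = 0) (t : GreyIndex ω d → F) :
    ∃ w : Fin ω → F, ∀ x ∈ N.1, α x * w x.1 + β x * w (cyclicPred x.1) = t x := by
  let T : (Fin ω → F) →ₗ[F] ({x // x ∈ N.1} → F) :=
    { toFun := fun w x => α x.1 * w x.1.1 + β x.1 * w (cyclicPred x.1.1)
      map_add' := fun w w' => by funext x; simp only [Pi.add_apply]; ring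
      map_smul' := fun a w => by
        funext x; simp only [Pi.smul_apply, smul_eq_mul, RingHom.id_apply]; ring }
  have hinj : Function.Injective T := by
    rw [injective_iff_map_eq_zero]
    exact fun w hw => h w fun x hx => congrFun hw ⟨x, hx⟩
  have hdim : Module.finrank F (Fin ω → F) = Module.finrank F ({x // x ∈ N.1} → F) := by
    simp [N.2.1]
  obtain ⟨w, hw⟩ :=
    (LinearMap.injective_iff_surjective_of_finrank_eq_finrank hdim).1 hinj fun x => t x.1
  exact ⟨w, fun x hx => congrFun hw ⟨x, hx⟩⟩

/-- Three functionals on a plane are dependent. This rules out a vanishing coefficient, which would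
leave three nodes of one receiver depending on only two coordinates. -/
theorem not_forall_exists_of_two_unknowns {a₁ b₁ a₂ b₂ c : F}
    (h : ∀ t₁ t₂ t₃, ∃ x y, a₁ * x + b₁ * y = t₁ ∧ a₂ * x + b₂ * y = t₂ ∧ c * y = t₃) :
    False := by
  obtain ⟨x, y, h1, h2, h3⟩ := h 0 0 1
  have hc : c ≠ 0 := by rintro rfl; simp at h3
  obtain ⟨x₁, y₁, h4, h5, h6⟩ := h 1 0 0
  obtain ⟨x₂, y₂, h7, h8, h9⟩ := h 0 1 0
  obtain rfl : y₁ = 0 := (mul_eq_zero.1 h6).resolve_left hc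
  obtain rfl : y₂ = 0 := (mul_eq_zero.1 h9).resolve_left hc
  simp only [mul_zero, add_zero] at h4 h5 h7 h8
  have ha : a₁ ≠ 0 := by rintro rfl; simp at h4
  have hx : x₂ = 0 := (mul_eq_zero.1 h7).resolve_left ha
  simp [hx] at h8

/-- A receiver with two nodes below a neighbouring `v` forces both coefficients of each node to be
nonzero, so the ratios are units. Two nodes below the same `v i` with equal ratio would be
proportional within a common receiver. A transversal with product `1` would have a nonzero kernel by
`exists_cyclic_solution`. -/
theorem exists_ratios_of_linearlySolvable (hω : 3 ≤ ω) (hd : ∀ i, 2 ≤ d i)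
    (h : (layeredNetwork ω d).LinearlySolvable F) :
    ∃ r : ∀ i, Fin (d i) → Fˣ, (∀ i, Function.Injective (r i)) ∧
      ∀ j : ∀ i, Fin (d i), ∏ i, r i (j i) ≠ 1 := by
  obtain ⟨α, β, hN⟩ := exists_coefficients_of_linearlySolvable h
  let z : ∀ i, Fin (d i) := fun i => ⟨0, by have := hd i; omega⟩
  let o : ∀ i, Fin (d i) := fun i => ⟨1, hd i⟩
  have hzo : ∀ i, z i ≠ o i := fun i => by simp [z, o]
  have hα : ∀ y, α y ≠ 0 := by
    rintro ⟨i, j⟩ h0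
    set p := cyclicPred i with hp
    have hpi : p ≠ i := cyclicPred_ne hω i
    have hself : Function.update z i j i = j := Function.update_self ..
    have hother : Function.update z i j p = z p := Function.update_of_ne hpi ..
    obtain ⟨N, h1, h2⟩ := exists_receiver_without_pred (Function.update z i j) p (j := o p)
      (by rw [hother]; exact hzo p)
    have h3 := h2 i (fun h => cyclicPred_cyclicPred_ne hω i h.symm)
    have h4 := h2 p (cyclicPred_ne hω p).symm
    rw [hself] at h3
    rw [hother] at h4
    refine not_forall_exists_of_two_unknowns (a₁ := β ⟨p, z p⟩) (b₁ := α ⟨p, z p⟩)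
      (a₂ := β ⟨p, o p⟩) (b₂ := α ⟨p, o p⟩) (c := β ⟨i, j⟩) fun t₁ t₂ t₃ => ?_
    obtain ⟨w, hw⟩ := exists_solution_of_receiver (hN N) fun y =>
      if y = ⟨i, j⟩ then t₃ else if y = ⟨p, z p⟩ then t₁ else t₂
    have e1 := hw _ h4
    have e2 := hw _ h1
    have e3 := hw _ h3
    rw [if_neg (by simp [hpi]), if_pos rfl] at e1
    rw [if_neg (by simp [hpi]), if_neg (by simpa using (hzo p).symm)] at e2
    rw [if_pos rfl, h0, zero_mul, zero_add] at e3
    exact ⟨w (cyclicPred p), w p, by rw [add_comm]; exact e1, by rw [add_comm]; exact e2, e3⟩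
  have hβ : ∀ y, β y ≠ 0 := by
    rintro ⟨i, j⟩ h0
    set s := finRotate ω i with hs
    have hsi : cyclicPred s = i := cyclicPred_finRotate i
    have hsne : s ≠ i := fun h => cyclicPred_ne hω s (hsi.trans h.symm)
    have hself : Function.update z i j i = j := Function.update_self ..
    have hother : Function.update z i j s = z s := Function.update_of_ne hsne ..
    obtain ⟨N, h1, h2⟩ := exists_receiver_without_succ (Function.update z i j) s (j := o s)
      (by rw [hother]; exact hzo s)
    have h3 := h2 i (fun h => cyclicPred_cyclicPred_ne hω s (by rw [hsi, h]))
    have h4 := h2 s (cyclicPred_ne hω s)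
    rw [hself] at h3
    rw [hother] at h4
    refine not_forall_exists_of_two_unknowns (a₁ := α ⟨s, z s⟩) (b₁ := β ⟨s, z s⟩)
      (a₂ := α ⟨s, o s⟩) (b₂ := β ⟨s, o s⟩) (c := α ⟨i, j⟩) fun t₁ t₂ t₃ => ?_
    obtain ⟨w, hw⟩ := exists_solution_of_receiver (hN N) fun y =>
      if y = ⟨i, j⟩ then t₃ else if y = ⟨s, z s⟩ then t₁ else t₂
    have e1 := hw _ h4
    have e2 := hw _ h1
    have e3 := hw _ h3
    rw [if_neg (by simp [hsne]), if_pos rfl] at e1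
    rw [if_neg (by simp [hsne]), if_neg (by simpa using (hzo s).symm)] at e2
    rw [if_pos rfl, h0, zero_mul, add_zero] at e3
    dsimp only at e1 e2 e3
    rw [hsi] at e1 e2
    exact ⟨w s, w i, e1, e2, e3⟩
  have hne : ∀ y, -β y / α y ≠ 0 := fun y => div_ne_zero (neg_ne_zero.2 (hβ y)) (hα y)
  have hmul : ∀ y, β y = -(-β y / α y * α y) := fun y => by
    rw [div_mul_cancel₀ _ (hα y), neg_neg]
  refine ⟨fun i j => Units.mk0 _ (hne ⟨i, j⟩), fun i j j' hjj => ?_, fun j hj => ?_⟩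
  · by_contra hne'
    have hρ : -β ⟨i, j⟩ / α ⟨i, j⟩ = -β ⟨i, j'⟩ / α ⟨i, j'⟩ := congrArg Units.val hjj
    have hself : Function.update z i j i = j := Function.update_self ..
    obtain ⟨N, h1, h2⟩ := exists_receiver_without_pred (Function.update z i j) i (j := j')
      (by rwa [hself])
    have h3 := h2 i (cyclicPred_ne hω i).symm
    rw [hself] at h3
    obtain ⟨w, hw⟩ := exists_solution_of_receiver (hN N) fun y => if y = ⟨i, j⟩ then 1 else 0
    have e1 := hw _ h3
    have e2 := hw _ h1
    rw [if_pos rfl] at e1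
    rw [if_neg (by simpa using Ne.symm hne')] at e2
    rw [hmul ⟨i, j⟩, hρ] at e1
    rw [hmul ⟨i, j'⟩] at e2
    dsimp only at e1 e2
    have e3 : α ⟨i, j'⟩ * (w i - -β ⟨i, j'⟩ / α ⟨i, j'⟩ * w (cyclicPred i)) = 0 := by
      linear_combination e2
    have e4 := (mul_eq_zero.1 e3).resolve_left (hα _)
    have : (1 : F) = 0 := by linear_combination -e1 + α ⟨i, j⟩ * e4
    exact one_ne_zero this
  · have hj' : ∏ i, (-β ⟨i, j i⟩ / α ⟨i, j i⟩) = 1 := by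
      have := congrArg Units.val hj
      simpa only [Units.coe_prod, Units.val_mk0, Units.val_one] using this
    obtain ⟨w, hw0, hw⟩ := exists_cyclic_solution (by omega) _ hj'
    obtain ⟨N, hNj⟩ := exists_receiver_transversal j
    refine hw0 (hN N w fun y hy => ?_)
    rw [hNj y hy]
    dsimp only
    rw [hw y.1, hmul ⟨y.1, j y.1⟩]
    field_simp [hα ⟨y.1, j y.1⟩]
    ring

end Criterion

open scoped Pointwise

/-! ### Kneser's theorem against the bound on the dimension -/

section Covering

/-- Under the hypotheses of the sharp bound, the product of the sets is the whole group. -/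
theorem one_mem_prod_of_sharpBound {G : Type*} [CommGroup G] [Finite G] {ω d : ℕ} (hω : 3 ≤ ω)
    (hd : 2 ≤ d) (hG : Nat.card G = 6 * d + 1) (h5 : ¬ 5 ∣ 6 * d + 1)
    (hbound : SharpBound ω (3 * d + 1) (6 * d + 2) d) (A : Fin ω → Set G)
    (hA : ∀ i, (A i).ncard = tupleWithLast ω d (2 * d) i) : (1 : G) ∈ ∏ i, A i := by
  by_contra hone
  have hAn : ∀ i, (A i).Nonempty := by
    intro i
    rw [← Set.ncard_pos, hA, tupleWithLast]
    split_ifs <;> omega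
  obtain ⟨H, hH⟩ : ∃ H, H = MulAction.stabilizer G (∏ i, A i) := ⟨_, rfl⟩
  have hk := kneser_prod A hAn Finset.univ Finset.univ subset_rfl H hH
  have hHS : (H : Set G) * ∏ i, A i = ∏ i, A i := by
    rw [hH, MulAction.stabilizer_mul_self]
  rw [hHS, Finset.card_univ, Fintype.card_fin] at hk
  obtain ⟨N, hN⟩ := Subgroup.card_subgroup_dvd_card H
  obtain ⟨u, hu⟩ := card_dvd_ncard_of_le_stabilizer hH.le
  have hHn : (1 : G) ∈ (H : Set G) := H.one_mem
  have hper : ∀ i, Nat.card H ∣ (A i * (H : Set G)).ncard := by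
    intro i
    apply card_dvd_ncard_of_le_stabilizer
    intro h hh
    rw [mul_comm]
    refine stabilizer_le_stabilizer_mul (H : Set G) (A i) ?_
    rwa [MulAction.stabilizer_subgroup]
  choose m hm using hper
  have hAm : ∀ i, (A i).ncard ≤ Nat.card H * m i := fun i => by
    rw [← hm]
    exact Set.ncard_le_ncard (Set.subset_mul_left _ hHn)
  have hlt : (∏ i, A i).ncard < Nat.card G := by
    rw [← Set.ncard_univ]
    exact Set.ncard_lt_ncard (Set.ssubset_univ_iff.2 fun h => hone (h ▸ Set.mem_univ _))
  generalize hh : Nat.card H = h at *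
  have hpos : 0 < h := by
    rw [← hh]
    exact Nat.card_pos
  simp only [hm, hu] at hk
  rw [← Finset.mul_sum] at hk
  have hsum : ∑ i, m i + 1 ≤ u + ω := by
    have : h * (∑ i, m i + 1) ≤ h * (u + ω) := by linarith
    exact Nat.le_of_mul_le_mul_left this hpos
  have huN : u < N := by
    rw [hu, hN] at hlt
    exact Nat.lt_of_mul_lt_mul_left hlt
  rw [hG] at hN
  have hm1 : ∀ i, 1 ≤ m i := by
    intro i
    by_contra hlt
    have h0 : m i = 0 := by omega
    have h1 := hAm i
    rw [h0, mul_zero] at h1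
    have := (Set.ncard_pos).2 (hAn i)
    omega
  have hωm : ω ≤ ∑ i, m i := by
    calc ω = ∑ _i : Fin ω, 1 := by simp
      _ ≤ _ := Finset.sum_le_sum fun i _ => hm1 i
  -- A stabilizer of order at least `d` has index `N < 7`. Since `6 * d + 1` is prime to `6`, only
  -- `N = 5` needs a hypothesis.
  by_cases hhd : d ≤ h
  · have hN2 : 2 ≤ N := by omega
    have hN6 : N < 7 := by
      by_contra hN7
      have := Nat.mul_le_mul hhd (not_lt.1 hN7)
      omega
    interval_cases N
    · omega
    · omega
    · omega
    · exact h5 ⟨h, by omega⟩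
    · omega
  · have hhd : h < d := not_le.1 hhd
    -- The bound is used at `d' = h`. There `c` and `e` are the least numbers of `H`-cosets that a
    -- set of size `d`, respectively `2 * d`, can meet.
    have hb := hbound h hpos hhd ⟨N, by omega⟩
    have hq : (0 : ℚ) < h := by exact_mod_cast hpos
    set c : ℤ := ⌈(d : ℚ) / h⌉ with hc
    have hc2 : 2 ≤ c := by
      have : (1 : ℤ) < c := by
        rw [hc, Int.lt_ceil, lt_div_iff₀ hq]
        simpa using (by exact_mod_cast hhd : (h : ℚ) < d)
      omega
    have he : ((3 * d + 1 : ℕ) : ℚ) - d - 1 = 2 * d := by push_cast; ring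
    have hNq : (((6 * d + 2 : ℕ) : ℚ) - 1) / h = N := by
      have : ((6 * d + 2 : ℕ) : ℚ) - 1 = h * N := by
        have : ((6 * d + 1 : ℕ) : ℚ) = ((h * N : ℕ) : ℚ) := by rw [hN]
        push_cast at this ⊢
        linarith
      rw [this, mul_div_cancel_left₀ _ hq.ne']
    rw [he, hNq] at hb
    set e : ℤ := ⌈(2 * d : ℚ) / h⌉ with he'
    have hcq : (0 : ℚ) < (c : ℚ) - 1 := by
      have : (2 : ℚ) ≤ c := by exact_mod_cast hc2
      linarith
    have hb' : (N : ℚ) - e ≤ ((ω : ℚ) - 1) * (c - 1) := by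
      rw [← div_le_iff₀ hcq]
      linarith
    have hb'' : (N : ℤ) - e ≤ ((ω : ℤ) - 1) * (c - 1) := by exact_mod_cast hb'
    obtain ⟨n, rfl⟩ : ∃ n, ω = n + 1 := ⟨ω - 1, by omega⟩
    have hmc : ∀ i : Fin n, c ≤ m i.castSucc := by
      intro i
      have h1 := hAm i.castSucc
      rw [hA, tupleWithLast, if_neg (by simp [i.isLt.ne])] at h1
      rw [hc, Int.ceil_le, div_le_iff₀ hq, mul_comm]
      exact_mod_cast h1
    have hme : e ≤ m (Fin.last n) := by
      have h1 := hAm (Fin.last n)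
      rw [hA, tupleWithLast, if_pos (by simp)] at h1
      rw [he', Int.ceil_le, div_le_iff₀ hq, mul_comm (m _ : ℤ).cast]
      exact_mod_cast h1
    have hsum' : (n : ℤ) * c + e ≤ ((∑ i, m i : ℕ) : ℤ) := by
      rw [Fin.sum_univ_castSucc]
      push_cast
      refine add_le_add ?_ hme
      calc (n : ℤ) * c = ∑ _i : Fin n, c := by simp
        _ ≤ _ := Finset.sum_le_sum fun i _ => hmc i
    have hz : ((∑ i, m i : ℕ) : ℤ) + 1 ≤ u + (n + 1) := by exact_mod_cast hsum
    have hz' : (u : ℤ) + 1 ≤ N := by exact_mod_cast huN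
    push_cast at hb''
    have : ((n : ℤ) + 1 - 1) * (c - 1) = n * c - n := by ring
    omega

end Covering

/-! ### Solvability by field size -/

section Fields

variable {ω d : ℕ} {F : Type*} [Field F]

theorem two_le_tupleWithLast (hd : 2 ≤ d) (i : Fin ω) : 2 ≤ tupleWithLast ω d (2 * d) i := by
  rw [tupleWithLast]
  split_ifs <;> omega

theorem ncard_range_fin {α : Type*} {m : ℕ} {f : Fin m → α} (hf : Function.Injective f) :
    (Set.range f).ncard = m := by
  rw [Set.ncard_range_of_injective hf, Nat.card_fin]

theorem not_linearlySolvable_of_sharpBound [Finite F] (hω : 3 ≤ ω) (hd : 2 ≤ d)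
    (hF : Nat.card F = 6 * d + 2) (h5 : ¬ 5 ∣ 6 * d + 1)
    (hbound : SharpBound ω (3 * d + 1) (6 * d + 2) d) :
    ¬ (layeredNetwork ω (tupleWithLast ω d (2 * d))).LinearlySolvable F := by
  intro h
  obtain ⟨r, hr, hprod⟩ := exists_ratios_of_linearlySolvable hω (two_le_tupleWithLast hd) h
  have := one_mem_prod_of_sharpBound hω hd (by rw [Nat.card_units, hF]; rfl) h5 hbound
    (fun i => Set.range (r i)) fun i => ncard_range_fin (hr i)
  rw [Set.mem_finsetProd] at this
  obtain ⟨g, hg, hg1⟩ := this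
  choose j hj using fun i => hg (i := i) (Finset.mem_univ i)
  exact hprod j (by simpa only [hj] using hg1)

/-- Fix the ratios outside one index of size `d` and the last one, of size `2 * d`. Ratios of the
first and inverses of the completed products of the second are `3 * d` values among fewer units, so
two coincide. -/
theorem not_linearlySolvable_of_card_lt [Finite F] (hω : 3 ≤ ω) (hd : 2 ≤ d)
    (hF : Nat.card F < 3 * d + 1) :
    ¬ (layeredNetwork ω (tupleWithLast ω d (2 * d))).LinearlySolvable F := by
  intro h
  obtain ⟨r, hr, hprod⟩ := exists_ratios_of_linearlySolvable hω (two_le_tupleWithLast hd) h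
  let a : Fin ω := ⟨0, by omega⟩
  let b : Fin ω := ⟨ω - 1, by omega⟩
  have hab : a ≠ b := by simp only [a, b, ne_eq, Fin.mk.injEq]; omega
  have ha : tupleWithLast ω d (2 * d) a = d := if_neg (by simp only [a]; omega)
  have hb : tupleWithLast ω d (2 * d) b = 2 * d := if_pos (by simp only [b]; omega)
  let z : ∀ i, Fin (tupleWithLast ω d (2 * d) i) :=
    fun i => ⟨0, by have := two_le_tupleWithLast (ω := ω) hd i; omega⟩
  set P : Fˣ := ∏ i ∈ (Finset.univ.erase a).erase b, r i (z i) with hP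
  let f : Fin (tupleWithLast ω d (2 * d) b) → Fˣ := fun y => (r b y * P)⁻¹
  have hf : Function.Injective f := fun y y' h =>
    hr b (mul_right_cancel (inv_injective h))
  have hinter : (Set.range (r a) ∩ Set.range f).Nonempty := by
    by_contra hne
    have h1 := Set.ncard_union_eq (Set.disjoint_iff_inter_eq_empty.2
      (Set.not_nonempty_iff_eq_empty.1 hne))
    rw [ncard_range_fin (hr a), ncard_range_fin hf] at h1
    have h2 := Set.ncard_le_ncard (Set.subset_univ (Set.range (r a) ∪ Set.range f))
    rw [Set.ncard_univ, Nat.card_units] at h2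
    omega
  obtain ⟨_, ⟨x, rfl⟩, y, hy⟩ := hinter
  apply hprod (Function.update (Function.update z a x) b y)
  rw [← Finset.mul_prod_erase _ _ (Finset.mem_univ a),
    ← Finset.mul_prod_erase _ _ (Finset.mem_erase.2 ⟨hab.symm, Finset.mem_univ b⟩),
    Function.update_of_ne hab, Function.update_self, Function.update_self]
  have : ∏ i ∈ (Finset.univ.erase a).erase b,
      r i (Function.update (Function.update z a x) b y i) = P := by
    refine Finset.prod_congr rfl fun i hi => ?_
    rw [Finset.mem_erase, Finset.mem_erase] at hi
    rw [Function.update_of_ne hi.1, Function.update_of_ne hi.2.1]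
  rw [this, ← hy]
  exact inv_mul_cancel _

theorem exists_injective_of_le_ncard {α : Type*} [Finite α] {Q : Set α} {m : ℕ}
    (h : m ≤ Q.ncard) : ∃ f : Fin m → α, Function.Injective f ∧ ∀ b, f b ∈ Q := by
  rw [← Nat.card_coe_set_eq] at h
  exact ⟨fun b => ((Finite.equivFin Q).symm (Fin.castLE h b)).1,
    Subtype.val_injective.comp ((Finite.equivFin Q).symm.injective.comp (Fin.castLE_injective h)),
    fun b => Subtype.prop _⟩

/-- If the products of elements of `Q` lie in a small set `P`, all ratios but the last may be taken
in `Q`, and the last ones outside `P⁻¹`. -/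
theorem linearlySolvable_of_set [Finite F] (hω : 0 < ω) {Q P : Set Fˣ} (hQ : d ≤ Q.ncard)
    (hP : P.ncard + 2 * d ≤ Nat.card Fˣ)
    (hQP : ∀ (s : Finset (Fin ω)) (g : Fin ω → Fˣ), s.card + 1 = ω → (∀ i ∈ s, g i ∈ Q) →
      ∏ i ∈ s, g i ∈ P) :
    (layeredNetwork ω (tupleWithLast ω d (2 * d))).LinearlySolvable F := by
  have hc : 2 * d ≤ ((P⁻¹)ᶜ : Set Fˣ).ncard := by
    have h1 := Set.ncard_add_ncard_compl (P⁻¹)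
    have h2 : (P⁻¹).ncard = P.ncard := Set.ncard_inv P
    omega
  let last : Fin ω := ⟨ω - 1, by omega⟩
  have key : ∀ i : Fin ω, ∃ f : Fin (tupleWithLast ω d (2 * d) i) → Fˣ, Function.Injective f ∧
      (i ≠ last → ∀ b, f b ∈ Q) ∧ (i = last → ∀ b, f b ∉ P⁻¹) := by
    intro i
    by_cases hi : i = last
    · have : tupleWithLast ω d (2 * d) i = 2 * d :=
        if_pos (by rw [hi]; simp only [last]; omega)
      obtain ⟨f, hf, hfm⟩ := exists_injective_of_le_ncard (this ▸ hc)
      exact ⟨f, hf, fun h => absurd hi h, fun _ => hfm⟩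
    · have : tupleWithLast ω d (2 * d) i = d :=
        if_neg fun h => hi (Fin.ext (by simp only [last]; omega))
      obtain ⟨f, hf, hfm⟩ := exists_injective_of_le_ncard (this ▸ hQ)
      exact ⟨f, hf, fun _ => hfm, fun h => absurd h hi⟩
  choose r hr hrQ hrP using key
  refine linearlySolvable_of_ratios r hr fun j hj => ?_
  rw [← Finset.mul_prod_erase _ _ (Finset.mem_univ last)] at hj
  apply hrP last rfl (j last)
  rw [Set.mem_inv, inv_eq_of_mul_eq_one_right hj]
  refine hQP _ (fun i => r i (j i)) ?_ fun i hi => hrQ i (Finset.ne_of_mem_erase hi) _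
  rw [Finset.card_erase_of_mem (Finset.mem_univ _), Finset.card_univ, Fintype.card_fin]
  omega

/-- Ratios can be chosen from a subgroup of index `m` and from its complement. -/
theorem linearlySolvable_of_dvd [Finite F] (hω : 0 < ω) {m n : ℕ} (hm : Nat.card F = m * n + 1)
    (hn : d ≤ n) (hmn : n + 2 * d ≤ m * n) :
    (layeredNetwork ω (tupleWithLast ω d (2 * d))).LinearlySolvable F := by
  have hcard : Nat.card Fˣ = m * n := by rw [Nat.card_units, hm]; rfl
  have hpos : 0 < Nat.card Fˣ := Nat.card_pos
  have hm0 : 0 < m := by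
    rcases Nat.eq_zero_or_pos m with rfl | h
    · simp at hcard; omega
    · exact h
  let H := (powMonoidHom m : Fˣ →* Fˣ).range
  have hH : (H : Set Fˣ).ncard = n := by
    rw [← Nat.card_coe_set_eq]
    refine (IsCyclic.card_powMonoidHom_range Fˣ m).trans ?_
    rw [hcard, Nat.gcd_eq_right (dvd_mul_right m n), Nat.mul_div_cancel_left _ hm0]
  exact linearlySolvable_of_set hω (Q := H) (P := H) (by omega) (by omega)
    fun s g _ hg => Subgroup.prod_mem H hg

/-- Any `d` units serve as `Q`: their `(ω - 1)`-fold products are too few to block the choice of `2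
* d` last ratios. -/
theorem linearlySolvable_of_large [Finite F] (hω : 0 < ω) (hF : d ^ ω + 2 * d + 1 ≤ Nat.card F)
    (hd : 0 < d) :
    (layeredNetwork ω (tupleWithLast ω d (2 * d))).LinearlySolvable F := by
  classical
  have hcard : Nat.card Fˣ + 1 = Nat.card F := by rw [Nat.card_units]; omega
  obtain ⟨f, hf, -⟩ := exists_injective_of_le_ncard (α := Fˣ) (Q := Set.univ) (m := d)
    (by rw [Set.ncard_univ]; omega)
  obtain ⟨n, rfl⟩ : ∃ n, ω = n + 1 := ⟨ω - 1, by omega⟩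
  let P : Set Fˣ := Set.range fun v : Fin n → Fin d => ∏ i, f (v i)
  have hP : P.ncard ≤ d ^ (n + 1) := by
    calc P.ncard ≤ Nat.card (Fin n → Fin d) := by
          rw [← Nat.card_coe_set_eq]
          exact Finite.card_range_le _
      _ = d ^ n := by simp
      _ ≤ _ := Nat.pow_le_pow_right hd (Nat.le_succ n)
  refine linearlySolvable_of_set hω (Q := Set.range f) (P := P) (ncard_range_fin hf).ge (by omega)
    fun s g hs hg => ?_
  have : Nonempty (Fin d) := ⟨⟨0, hd⟩⟩
  choose! j hj using hg
  let e : Fin n ≃ s := (Fintype.equivFinOfCardEq (by simpa using hs)).symm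
  refine ⟨fun i => j (e i), ?_⟩
  rw [← Finset.prod_coe_sort s]
  rw [← Equiv.prod_comp e]
  exact Finset.prod_congr rfl fun i _ => hj _ (e i).2

end Fields

/-! ### The largest field without a solution -/

section Extremal

variable {ω d : ℕ}

/-- A finite field of more than `6 d + 1` elements over which there is no linear solution has as its
size an odd power of `2`. -/
theorem card_eq_two_pow_odd_of_not_linearlySolvable (hω : 0 < ω) {F : Type*} [Field F] [Finite F]
    (hF : 6 * d + 2 ≤ Nat.card F)
    (h : ¬ (layeredNetwork ω (tupleWithLast ω d (2 * d))).LinearlySolvable F) :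
    ∃ k, Nat.card F = 2 ^ (2 * k + 1) := by
  have hpp : IsPrimePow (Nat.card F) := by
    have := Fintype.ofFinite F
    rw [Nat.card_eq_fintype_card]
    exact FiniteField.isPrimePow_card F
  obtain ⟨p, n, hp, hn, hpn⟩ := (isPrimePow_nat_iff _).1 hpp
  rcases Nat.even_or_odd' (Nat.card F) with ⟨c, hc | hc⟩
  · have hp2 : p = 2 := by
      have : 2 ∣ p ^ n := ⟨c, by rw [hpn, hc]⟩
      exact ((Nat.prime_dvd_prime_iff_eq Nat.prime_two hp).1
        (Nat.prime_two.dvd_of_dvd_pow this)).symm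
    subst hp2
    rcases Nat.even_or_odd' n with ⟨l, rfl | rfl⟩
    · exfalso
      have hmod : 2 ^ (2 * l) % 3 = 1 := by
        rw [pow_mul, Nat.pow_mod]
        simp
      rw [hpn] at hmod
      -- Since `4 ^ l` is `1` modulo `3`, the floor `Nat.card F / 3` is exactly `(|F| - 1) / 3`, the
      -- order of the subgroup of index `3`.
      exact h (linearlySolvable_of_dvd hω (m := 3) (n := Nat.card F / 3) (by omega) (by omega)
        (by omega))
    · exact ⟨l, hpn.symm⟩
  · exact absurd (linearlySolvable_of_dvd hω (m := 2) (n := c) hc (by omega) (by omega)) h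

/-- `linearlySolvable_of_large` bounds the unsolvable sizes. As one of them exceeds `1`, the maximum
is not the conventional value `1`. -/
theorem exists_isQStarMax (hω : 0 < ω) (hd : 0 < d) {q : ℕ}
    (hq : q ∈ (layeredNetwork ω (tupleWithLast ω d (2 * d))).unsolvableSizes) (hq1 : 1 < q) :
    ∃ Q, q ≤ Q ∧ (layeredNetwork ω (tupleWithLast ω d (2 * d))).IsQStarMax Q ∧
      Q ∈ (layeredNetwork ω (tupleWithLast ω d (2 * d))).unsolvableSizes := by
  set N := layeredNetwork ω (tupleWithLast ω d (2 * d)) with hN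
  have hbdd : BddAbove (insert 1 N.unsolvableSizes) := by
    refine ⟨d ^ ω + 2 * d + 1, ?_⟩
    rintro _ (rfl | ⟨F, hF, hfin, rfl, hns⟩)
    · omega
    · by_contra hlt
      exact hns (linearlySolvable_of_large hω (by omega) hd)
  have hmem := Nat.sSup_mem (Set.insert_nonempty _ _) hbdd
  have hle := le_csSup hbdd (Set.mem_insert_of_mem 1 hq)
  refine ⟨_, hle, ⟨hmem, fun x hx => le_csSup hbdd hx⟩, hmem.resolve_left ?_⟩
  omega

end Extremal

end MulticastNetwork

theorem theorem4 (k : ℕ) (hk : 2 < k) (d : ℕ) (hd : d = (2 ^ (2 * k) - 1) / 3)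
    (ω : ℕ) (hω : 3 ≤ ω)
    (hbound : MulticastNetwork.SharpBound ω (2 ^ (2 * k)) (2 ^ (2 * k + 1)) d) :
    (MulticastNetwork.layeredNetwork ω
        (MulticastNetwork.tupleWithLast ω d (2 * d))).LinearlySolvable (GaloisField 2 (2 * k)) ∧
    ¬ (MulticastNetwork.layeredNetwork ω
        (MulticastNetwork.tupleWithLast ω d (2 * d))).LinearlySolvable
          (GaloisField 2 (2 * k + 1)) ∧
    (MulticastNetwork.layeredNetwork ω
        (MulticastNetwork.tupleWithLast ω d (2 * d))).IsQMin (2 ^ (2 * k)) ∧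
    ∃ k' : ℕ, k ≤ k' ∧
      (MulticastNetwork.layeredNetwork ω
        (MulticastNetwork.tupleWithLast ω d (2 * d))).IsQStarMax (2 ^ (2 * k' + 1)) := by
  have hmod : 2 ^ (2 * k) % 3 = 1 := by
    rw [pow_mul, Nat.pow_mod]
    simp
  have hq : 2 ^ (2 * k) = 3 * d + 1 := by
    generalize 2 ^ (2 * k) = q at *
    omega
  have hq' : 2 ^ (2 * k + 1) = 6 * d + 2 := by rw [pow_succ, hq]; ring
  have hd2 : 2 ≤ d := by
    have : 2 ^ 6 ≤ 2 ^ (2 * k) := Nat.pow_le_pow_right (by norm_num) (by omega)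
    omega
  -- Odd powers of `2` alternate between `2` and `3` modulo `5`, so `q' - 1` is never divisible by
  -- `5`.
  have h5 : ¬ 5 ∣ 6 * d + 1 := by
    have h : 2 ^ (2 * k + 1) % 5 = 2 ∨ 2 ^ (2 * k + 1) % 5 = 3 := by
      clear * -
      induction k with
      | zero => simp
      | succ k ih =>
        rw [show 2 * (k + 1) + 1 = 2 * k + 1 + 2 by ring, pow_add]
        omega
    omega
  have hcard : Nat.card (GaloisField 2 (2 * k)) = 2 ^ (2 * k) := GaloisField.card 2 _ (by omega)
  have hcard' : Nat.card (GaloisField 2 (2 * k + 1)) = 2 ^ (2 * k + 1) :=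
    GaloisField.card 2 _ (by omega)
  have hsol : (MulticastNetwork.layeredNetwork ω
      (MulticastNetwork.tupleWithLast ω d (2 * d))).LinearlySolvable (GaloisField 2 (2 * k)) :=
    MulticastNetwork.linearlySolvable_of_dvd (by omega) (hcard.trans hq) le_rfl (by omega)
  have hunsol : ¬ (MulticastNetwork.layeredNetwork ω
      (MulticastNetwork.tupleWithLast ω d (2 * d))).LinearlySolvable
        (GaloisField 2 (2 * k + 1)) :=
    MulticastNetwork.not_linearlySolvable_of_sharpBound hω hd2 (hcard'.trans hq') h5
      (by rwa [hq, hq'] at hbound)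
  refine ⟨hsol, hunsol, ⟨⟨_, _, inferInstance, hcard, hsol⟩, ?_⟩, ?_⟩
  · rintro _ ⟨F, hF, hfin, rfl, hs⟩
    by_contra hlt
    exact MulticastNetwork.not_linearlySolvable_of_card_lt hω hd2 (by omega) hs
  · obtain ⟨Q, hle, hmax, F, hF, hfin, rfl, hns⟩ := MulticastNetwork.exists_isQStarMax
      (by omega) (by omega) ⟨_, _, inferInstance, hcard', hunsol⟩ (by omega)
    obtain ⟨k', hk'⟩ := MulticastNetwork.card_eq_two_pow_odd_of_not_linearlySolvable
      (by omega) (by omega) hns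
    refine ⟨k', ?_, hk' ▸ hmax⟩
    rw [hk'] at hle
    have := (Nat.pow_le_pow_iff_right (by norm_num : 1 < 2)).1 hle
    omega
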